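/- **Algorithms.** A *multiple access randomized logspace algorithm* is a probabilistic random-access machine which, on a binary input $x$ of length $\ell$ to which it has multiple (random) access, with read-once access to a uniformly random bit string $r_{ro}$ and multiple (random) access to an independent uniformly random bit string $r_{ma}$, both of length at most $\mathrm{poly}(\ell)$, computes an output bit in time $\mathrm{poly}(\ell)$ using $O(\log \ell)$ bits of working space (for every input and all random strings). A *randomized logspace algorithm* is one that has no string $r_{ma}$. **Distributions.** For $s\ge 2$, $\mathsf{HG}^s(n,1/2)$ is the random $s$-uniform hypergraph on $\{1,\dots,n\}$ in which each possible hyperedge is present independently with probability $1/2$. For $k\le n$, $\mathsf{HG}^s(n,1/2,k)$ is obtained by choosing a uniformly random set $K$ of $k$ vertices, including all hyperedges contained in $K$, and including every other possible hyperedge independently with probability $1/2$. For $s-2\le k\le n$, $\mathsf{clHG}^s(n,1/2,k)$ is $\mathsf{HG}^s(n,1/2,k)$ conditioned on the event that the vertices $1,\dots,s-2$ belong to $K$. For $s=2$ these are graphs, and we write $\mathsf G(n,1/2)=\mathsf{HG}^2(n,1/2)$ and $\mathsf G(n,1/2,k)=\mathsf{HG}^2(n,1/2,k)$. **Conjecture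 (clHPC-Conj-Space).** For every randomized logspace algorithm $\mathcal A$, every constant integer $s\ge 3$, and all non-decreasing sequences of positive integers $n\to\infty$ and $k$ with $s-2\le k\le n$ and $k=O(n^{1/2-\delta})$ for some constant $\delta>0$, $$\Pr_{A\sim \mathsf{HG}^s(n,1/2),\,r_{ro}}\big(\mathcal A(\{n,k,A,s\},r_{ro})=0\big)+\Pr_{A\sim \mathsf{clHG}^s(n,1/2,k),\,r_{ro}}\big(\mathcal A(\{n,k,A,s\},r_{ro})=1\big)=1+o(1).$$ **Statement.** Let $n\to\infty$ and $k\le n$ be non-decreasing sequences of positive integers with $k=O(n^{1/2-\delta})$ for some constant $\delta>0$. If clHPC-Conj-Space is true, then no multiple access randomized logspace algorithm (whatever polynomial number of multiple access random bits it uses) solves the planted clique detection problem $\mathsf{PC_D}(n,k)$; that is, for no such algorithm $\mathcal S$ is there a constant $c>0$ such that, for all sufficiently late terms of the sequences, $$\Pr_{A\sim \mathsf{G}(n,1/2),\,r_{ro},r_{ma}}\big(\mathcal S(\{n,k,A\},r_{ro},r_{ma})=0\big)+\Pr_{A\sim \mathsf{G}(n,1/2,k),\,r_{ro},r_{ma}}\big(\mathcal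 S(\{n,k,A\},r_{ro},r_{ma})=1\big)\ \ge\ 1+c .$$ -/

import Mathlib

open Filter Topology Asymptotics MeasureTheory
open scoped ENNReal NNReal

namespace PlantedClique

/-! ### Random-access machines -/

/-- The binary operations on registers. -/
inductive ArithOp
  | add | sub | mul | div | mod

/-- Value of an operation (subtraction is truncated at zero, `a / 0 = 0`, `a % 0 = a`). -/
def ArithOp.eval : ArithOp → ℕ → ℕ → ℕ
  | .add, a, b => a + b
  | .sub, a, b => a - b
  | .mul, a, b => a * b
  | .div, a, b => a / b
  | .mod, a, b => a % b

/-- Instructions of a random-access machine with control states `Q` and index registers `R`.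
A register holds a natural number (the contents of a binary index tape). The argument `next`
is the control state that follows. -/
inductive Instr (Q R : Type)
  /-- `dst := v` -/
  | const (dst : R) (v : ℕ) (next : Q)
  /-- `dst := op a b` -/
  | arith (op : ArithOp) (dst a b : R) (next : Q)
  /-- go to `yes` if `a < b`, and to `no` otherwise -/
  | branch (a b : R) (yes no : Q)
  /-- `dst :=` the input bit at the address in `addr` (`2` if the address is past the end) -/
  | readInput (dst addr : R) (next : Q)
  /-- `dst :=` the work tape bit at the address in `addr` -/
  | readWork (dst addr : R) (next : Q)
  /-- write on the work tape, at the address in `addr`, the bit `1` if `src` is nonzero,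
  and the bit `0` otherwise -/
  | writeWork (addr src : R) (next : Q)
  /-- `dst :=` the next bit of the read-once random string -/
  | readOnce (dst : R) (next : Q)
  /-- `dst :=` the bit, at the address in `addr`, of the multiple access random string -/
  | readMulti (dst addr : R) (next : Q)
  /-- stop with output bit `b` -/
  | halt (b : Bool)

/-- A probabilistic random-access machine: a finite control, finitely many index registers, a
bit-addressable work tape, a random-access read-only input, a one-way read-once random string
and a random-access read-only (multiple access) random string. -/
structure Machine where
  State : Type
  Reg : Type
  [stateFintype : Fintype State]
  [regFintype : Fintype Reg]
  [regDecidableEq : DecidableEq Reg]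
  start : State
  code : State → Instr State Reg

attribute [instance] Machine.stateFintype Machine.regFintype Machine.regDecidableEq

/-- A configuration. `used` is the number of read-once random bits that were consumed. -/
structure Config (Q R : Type) where
  state : Q
  reg : R → ℕ
  work : ℕ → Bool
  used : ℕ

/-- The content of a register after reading an input symbol; `none` is the end of the input. -/
def symbolValue : Option Bool → ℕ
  | some b => b.toNat
  | none => 2

namespace Machine

variable (M : Machine)

/-- One step on input `x`, with read-once random bits `ro` and multiple access random
bits `ma`. A halted configuration does not change. -/
def step (x : List Bool) (ro ma : ℕ → Bool) (c : Config M.State M.Reg) :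
    Config M.State M.Reg :=
  match M.code c.state with
  | .const dst v next => { c with state := next, reg := Function.update c.reg dst v }
  | .arith op dst a b next =>
      { c with
        state := next
        reg := Function.update c.reg dst (op.eval (c.reg a) (c.reg b)) }
  | .branch a b yes no => { c with state := if c.reg a < c.reg b then yes else no }
  | .readInput dst addr next =>
      { c with
        state := next
        reg := Function.update c.reg dst (symbolValue x[c.reg addr]?) }
  | .readWork dst addr next =>
      { c with
        state := next
        reg := Function.update c.reg dst (c.work (c.reg addr)).toNat }
  | .writeWork addr src next =>
      { c with
        state := next
        work := Function.update c.work (c.reg addr) (decide (c.reg src ≠ 0)) }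
  | .readOnce dst next =>
      { c with
        state := next
        reg := Function.update c.reg dst (ro c.used).toNat
        used := c.used + 1 }
  | .readMulti dst addr next =>
      { c with
        state := next
        reg := Function.update c.reg dst (ma (c.reg addr)).toNat }
  | .halt _ => c

/-- The configuration in which a computation starts. -/
def startConfig : Config M.State M.Reg where
  state := M.start
  reg := fun _ => 0
  work := fun _ => false
  used := 0

/-- The configuration after `t` steps. -/
def run (x : List Bool) (ro ma : ℕ → Bool) (t : ℕ) : Config M.State M.Reg :=
  (M.step x ro ma)^[t] M.startConfig

/-- The machine has stopped within `t` steps, with output bit `b`. -/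
def OutputsWithin (x : List Bool) (ro ma : ℕ → Bool) (b : Bool) (t : ℕ) : Prop :=
  M.code (M.run x ro ma t).state = .halt b

/-- The machine stops with output bit `b`. -/
def Outputs (x : List Bool) (ro ma : ℕ → Bool) (b : Bool) : Prop :=
  ∃ t, M.OutputsWithin x ro ma b t

/-- The configuration occupies at most `B` bits: the binary lengths of all the registers,
together with a prefix of the work tape outside of which the tape is blank. -/
def SpaceAtMost {M : Machine} (c : Config M.State M.Reg) (B : ℕ) : Prop :=
  ∃ u : ℕ, (∀ i, u ≤ i → c.work i = false) ∧ (∑ r, Nat.size (c.reg r)) + u ≤ B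

/-- A multiple access randomized logspace algorithm: on every input of length `ℓ` and for all
random strings it stops in time polynomial in `ℓ` and occupies `O(log ℓ)` bits all along.
The random strings are written as infinite sequences. By the time bound only polynomially many
bits of the read-once string are read; an address in the multiple access string sits in a
register of `O(log ℓ)` bits, so only a prefix of polynomial length of that string is
accessible. -/
def IsMultipleAccessLogspace : Prop :=
  ∃ c : ℕ, ∀ (x : List Bool) (ro ma : ℕ → Bool),
    (∃ b, M.OutputsWithin x ro ma b (x.length ^ c + c)) ∧
    ∀ t, SpaceAtMost (M.run x ro ma t) (c * Nat.log 2 x.length + c)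

/-- The machine has no access to a multiple access random string. -/
def NoMultipleAccess : Prop :=
  ∀ q dst addr next, M.code q ≠ .readMulti dst addr next

/-- A randomized logspace algorithm: the same resource bounds, and all the randomness is
read-once. -/
def IsRandomizedLogspace : Prop :=
  M.IsMultipleAccessLogspace ∧ M.NoMultipleAccess

end Machine

/-- The law of an infinite sequence of independent uniformly random bits. -/
noncomputable def coinMeasure : Measure (ℕ → Bool) :=
  Measure.infinitePi fun _ : ℕ => (PMF.uniformOfFintype Bool).toMeasure

/-- The probability that `M` outputs `b` when its input has law `P` and its two random strings
are uniformly random, independent of each other and of the input. (If `M` has no multiple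
access, its output does not depend on the second string.) -/
noncomputable def outputProb (M : Machine) (P : PMF (List Bool)) (b : Bool) : ℝ≥0∞ :=
  ∑' x, P x * (coinMeasure.prod coinMeasure) {r | M.Outputs x r.1 r.2 b}

/-! ### Hypothesis testing -/

/-- Two sequences of sets of distributions over binary strings. -/
structure TestingProblem where
  null : ℕ → Set (PMF (List Bool))
  alternative : ℕ → Set (PMF (List Bool))

/-- The sum of the two worst-case success probabilities is `1 + Ω(1)`. -/
def Solves (M : Machine) (T : TestingProblem) : Prop :=
  ∃ c : ℝ≥0, 0 < c ∧ ∀ᶠ i in atTop,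
    1 + (c : ℝ≥0∞) ≤ (⨅ P ∈ T.null i, outputProb M P false) +
      ⨅ P ∈ T.alternative i, outputProb M P true

/-! ### Random hypergraphs -/

/-- An `s`-uniform hypergraph with vertex set `Fin n`, given by the indicators of its
hyperedges. For `s = 2` this is a graph. -/
abbrev UniformHypergraph (s n : ℕ) : Type :=
  {e : Finset (Fin n) // e.card = s} → Bool

/-- Add all hyperedges inside `K`. -/
def plant {s n : ℕ} (K : Finset (Fin n)) (G : UniformHypergraph s n) : UniformHypergraph s n :=
  fun e => decide (e.1 ⊆ K) || G e

/-- The Erdős–Rényi hypergraph: the hyperedge indicators are independent fair bits. -/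
noncomputable def erdosRenyi (s n : ℕ) : PMF (UniformHypergraph s n) :=
  PMF.uniformOfFintype (UniformHypergraph s n)

theorem powersetCard_univ_nonempty {n k : ℕ} (hkn : k ≤ n) :
    (Finset.powersetCard k (Finset.univ : Finset (Fin n))).Nonempty :=
  Finset.powersetCard_nonempty.2 (by simpa using hkn)

/-- The joint law of `(K, G)`: the clique set `K` is uniform among the vertex sets of size `k`,
the hyperedges inside `K` are present, all others are present independently with
probability `1/2`. -/
noncomputable def plantedJoint (s n k : ℕ) (hkn : k ≤ n) :
    PMF (Finset (Fin n) × UniformHypergraph s n) :=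
  (PMF.uniformOfFinset _ (powersetCard_univ_nonempty hkn)).bind fun K =>
    (erdosRenyi s n).map fun G => (K, plant K G)

/-- The planted clique distribution on `s`-uniform hypergraphs. -/
noncomputable def planted (s n k : ℕ) (hkn : k ≤ n) : PMF (UniformHypergraph s n) :=
  (plantedJoint s n k hkn).map Prod.snd

/-- The event that the first `s - 2` vertices are in the clique set. -/
def leakEvent (s n : ℕ) : Set (Finset (Fin n) × UniformHypergraph s n) :=
  {p | ∀ v : Fin n, v.val < s - 2 → v ∈ p.1}

theorem leakEvent_possible {s n k : ℕ} (hsk : s - 2 ≤ k) (hkn : k ≤ n) :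
    ∃ p ∈ leakEvent s n, p ∈ (plantedJoint s n k hkn).support := by
  classical
  obtain ⟨K, hsub, -, hcard⟩ := Finset.exists_subsuperset_card_eq
    (s := Finset.univ.filter fun v : Fin n => v.val < s - 2) (t := Finset.univ) (n := k)
    (Finset.subset_univ _)
    (by
      have h : (Finset.univ.filter fun v : Fin n => v.val < s - 2).card ≤ s - 2 := by
        rw [← Finset.card_range (s - 2)]
        refine Finset.card_le_card_of_injOn (fun v => v.val) (fun v hv => ?_)
          (fun a _ b _ h => Fin.ext h)
        simpa using hv
      exact h.trans hsk)
    (by simpa using hkn)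
  refine ⟨(K, plant K fun _ => false), fun v hv => hsub (by simpa using hv), ?_⟩
  rw [plantedJoint, PMF.mem_support_bind_iff]
  refine ⟨K, ?_, ?_⟩
  · rw [PMF.mem_support_uniformOfFinset_iff]
    simp [Finset.mem_powersetCard, hcard]
  · rw [PMF.mem_support_map_iff]
    exact ⟨fun _ => false, PMF.mem_support_uniformOfFintype _, rfl⟩

/-- The clique leakage distribution: the planted clique distribution conditioned on the event
that the first `s - 2` vertices are in the clique set. -/
noncomputable def cliqueLeakage (s n k : ℕ) (hsk : s - 2 ≤ k) (hkn : k ≤ n) :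
    PMF (UniformHypergraph s n) :=
  ((plantedJoint s n k hkn).filter (leakEvent s n) (leakEvent_possible hsk hkn)).map Prod.snd

/-! ### Encoding of the inputs -/

/-- A number, self-delimiting. -/
def encodeNat (m : ℕ) : List Bool := List.replicate m true ++ [false]

/-- The `n ^ s` bits of the adjacency tensor: the entry at `(v₁, …, vₛ)` is `1` if and only if
the `vᵢ` are distinct and form a hyperedge. For `s = 2` it is the adjacency matrix. -/
def adjacencyBits {s n : ℕ} (G : UniformHypergraph s n) : List Bool :=
  List.ofFn fun j : Fin (n ^ s) =>
    if h : (Finset.univ.image (finFunctionFinEquiv.symm j)).card = s then G ⟨_, h⟩ else false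

/-- The triple `(n, k, A)` as a binary string. -/
def encodeGraph (n k : ℕ) (G : UniformHypergraph 2 n) : List Bool :=
  encodeNat n ++ encodeNat k ++ adjacencyBits G

/-- The quadruple `(n, k, A, s)` as a binary string. -/
def encodeHypergraph (s n k : ℕ) (G : UniformHypergraph s n) : List Bool :=
  encodeNat n ++ encodeNat k ++ adjacencyBits G ++ encodeNat s

/-! ### The two detection problems -/

/-- The planted clique detection problem along the sequences `n` and `k`. -/
noncomputable def pcDetection (n k : ℕ → ℕ) (hkn : ∀ i, k i ≤ n i) : TestingProblem where
  null i := {(erdosRenyi 2 (n i)).map (encodeGraph (n i) (k i))}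
  alternative i := {(planted 2 (n i) (k i) (hkn i)).map (encodeGraph (n i) (k i))}

/-- The clique leakage logspace hypergraph planted clique conjecture. The condition
`s - 2 ≤ k i` says that the event in the conditioning has positive probability. -/
def ClHPCConjSpace : Prop :=
  ∀ A : Machine, A.IsRandomizedLogspace →
  ∀ s : ℕ, 3 ≤ s →
  ∀ n k : ℕ → ℕ, Monotone n → Monotone k → (∀ i, 0 < n i) → (∀ i, 0 < k i) →
  Tendsto n atTop atTop →
  ∀ (hsk : ∀ i, s - 2 ≤ k i) (hkn : ∀ i, k i ≤ n i),
  (∃ δ : ℝ, 0 < δ ∧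
    (fun i => (k i : ℝ)) =O[atTop] fun i => (n i : ℝ) ^ (1 / 2 - δ)) →
  Tendsto (fun i =>
      outputProb A ((erdosRenyi s (n i)).map (encodeHypergraph s (n i) (k i))) false +
      outputProb A
        ((cliqueLeakage s (n i) (k i) (hsk i) (hkn i)).map (encodeHypergraph s (n i) (k i)))
        true)
    atTop (𝓝 1)

end PlantedClique

/-!
Let `S` be a multiple access randomized logspace algorithm that solves the planted clique detection
problem for graphs with `n` vertices and clique size `k`. A randomized logspace algorithm that
distinguishes random hypergraphs from hypergraphs with a leaked clique is obtained as follows,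
which contradicts the conjecture.

Let `s = t + 2` be large in comparison with the resource bounds of `S`, and consider
`s`-uniform hypergraphs on `t + n` vertices with clique size `t + k`, where the first `t` vertices
are known to be in the clique. The link of the set of these `t` vertices is a graph on `n`
vertices: the pair `{u, v}` is an edge if it forms a hyperedge together with the first `t`
vertices. If the hypergraph is random then so is this graph, and if the hypergraph has a leaked
clique then this graph has a planted clique of size `k`. Hyperedges that consist of `s` of the
other `n` vertices serve as the multiple access random bits. A register of logarithmic length addresses only
polynomially many, say `N`, such bits, so that for large `s` there are `N` distinct hyperedges
for them. These bits are independent of the graph and uniform, except if the clique contains one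
of the hyperedges in question. A fixed set of `s` vertices is in the clique with probability at
most `(k / n) ^ s`, and since `k = O(√n)`, the union bound `N * (k / n) ^ s` tends to `0` if `s` is
large.

All that has to be computed is a translation of addresses: `S` is run on a virtual graph and on a
virtual random string, whose bits are looked up in the adjacency tensor of the hypergraph when
they are needed. The translation is an arithmetic expression in the address, and it takes constant
time and `O(log)` space. Machines that evaluate such expressions are obtained by compiling programs
(`Program.compile_spec`); the simulating machine is `exists_simulating_machine`. The virtual
objects are identified in `virtualInput_encodeHypergraph` and `virtualMulti_encodeHypergraph`, and
the laws of the inputs are compared in `outputProb_null` and `outputProb_planted_le`, the latter by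
means of the description `cliqueLeakage_eq` of the clique leakage distribution.
-/

namespace PlantedClique

/-! ### Programs with expressions -/

/-- Arithmetic expressions over registers that may also read the input. -/
inductive Expr (R : Type)
  | var (r : R)
  | const (v : ℕ)
  | op (o : ArithOp) (a b : Expr R)
  /-- the symbol of the input at the address given by the value of `a` -/
  | read (a : Expr R)

namespace Expr

variable {R : Type}

/-- The value of an expression on input `x` when the registers contain `ρ`. -/
def eval (x : List Bool) (ρ : R → ℕ) : Expr R → ℕ
  | var r => ρ r
  | const v => v
  | op o a b => o.eval (a.eval x ρ) (b.eval x ρ)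
  | read a => symbolValue x[a.eval x ρ]?

/-- The number of temporary registers, besides the one that receives the result, that suffice
for the evaluation. -/
def depth : Expr R → ℕ
  | var _ => 0
  | const _ => 0
  | op _ a b => max a.depth (b.depth + 1)
  | read a => a.depth

/-- A factor by which the evaluation may increase the binary length of the numbers involved. -/
def weight : Expr R → ℕ
  | var _ => 1
  | const v => Nat.size v
  | op _ a b => a.weight + b.weight + 1
  | read a => a.weight + 2

end Expr

theorem size_mul_le (a b : ℕ) : Nat.size (a * b) ≤ Nat.size a + Nat.size b := by
  rw [Nat.size_le, pow_add]
  exact Nat.mul_lt_mul'' (Nat.lt_size_self a) (Nat.lt_size_self b)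

theorem size_add_le (a b : ℕ) : Nat.size (a + b) ≤ Nat.size a + Nat.size b + 1 := by
  rw [Nat.size_le, pow_add, pow_add]
  have ha := Nat.lt_size_self a
  have hb := Nat.lt_size_self b
  have h1 : 1 ≤ 2 ^ Nat.size a := Nat.one_le_two_pow
  have h2 : 1 ≤ 2 ^ Nat.size b := Nat.one_le_two_pow
  nlinarith

theorem ArithOp.size_eval_le (o : ArithOp) (a b : ℕ) :
    Nat.size (o.eval a b) ≤ Nat.size a + Nat.size b + 1 := by
  cases o
  · exact size_add_le a b
  · exact (Nat.size_le_size (Nat.sub_le a b)).trans (by omega)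
  · exact (size_mul_le a b).trans (by omega)
  · exact (Nat.size_le_size (Nat.div_le_self a b)).trans (by omega)
  · exact (Nat.size_le_size (Nat.mod_le a b)).trans (by omega)

theorem size_symbolValue_le (o : Option Bool) : Nat.size (symbolValue o) ≤ 2 := by
  rw [Nat.size_le]
  rcases o with _ | _ | _ <;> simp [symbolValue]

theorem Expr.size_eval_le {R : Type} (x : List Bool) (ρ : R → ℕ) (B : ℕ)
    (h : ∀ r, Nat.size (ρ r) ≤ B) (e : Expr R) :
    Nat.size (e.eval x ρ) ≤ e.weight * (B + 1) := by
  induction e with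
  | var r => simpa [eval, weight] using (h r).trans (Nat.le_succ B)
  | const v => simpa [eval, weight] using Nat.le_mul_of_pos_right _ (Nat.succ_pos B)
  | op o a b iha ihb =>
      refine (o.size_eval_le _ _).trans ?_
      simp only [weight, add_mul]
      omega
  | read a _ =>
      refine (size_symbolValue_le _).trans ?_
      simp only [weight, add_mul]
      omega

/-- The effect of an instruction on a configuration. -/
def Instr.act {Q R : Type} [DecidableEq R] (x : List Bool) (ro ma : ℕ → Bool)
    (c : Config Q R) : Instr Q R → Config Q R
  | .const dst v next => { c with state := next, reg := Function.update c.reg dst v }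
  | .arith op dst a b next =>
      { c with
        state := next
        reg := Function.update c.reg dst (op.eval (c.reg a) (c.reg b)) }
  | .branch a b yes no => { c with state := if c.reg a < c.reg b then yes else no }
  | .readInput dst addr next =>
      { c with
        state := next
        reg := Function.update c.reg dst (symbolValue x[c.reg addr]?) }
  | .readWork dst addr next =>
      { c with
        state := next
        reg := Function.update c.reg dst (c.work (c.reg addr)).toNat }
  | .writeWork addr src next =>
      { c with
        state := next
        work := Function.update c.work (c.reg addr) (decide (c.reg src ≠ 0)) }
  | .readOnce dst next =>
      { c with
        state := next
        reg := Function.update c.reg dst (ro c.used).toNat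
        used := c.used + 1 }
  | .readMulti dst addr next =>
      { c with
        state := next
        reg := Function.update c.reg dst (ma (c.reg addr)).toNat }
  | .halt _ => c

theorem Machine.step_eq (M : Machine) (x : List Bool) (ro ma : ℕ → Bool)
    {c : Config M.State M.Reg} {i : Instr M.State M.Reg} (h : M.code c.state = i) :
    M.step x ro ma c = i.act x ro ma c := by
  subst h
  rw [Machine.step]
  cases M.code c.state <;> rfl

/-- The instructions of straight-line code. -/
inductive Flat (R : Type)
  | const (dst : R) (v : ℕ)
  | arith (op : ArithOp) (dst a b : R)
  | readInput (dst addr : R)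

namespace Flat

variable {R Q : Type}

/-- The machine instruction that does `i` and continues in the state `next`. -/
def toInstr : Flat R → Q → Instr Q R
  | const dst v, next => .const dst v next
  | arith op dst a b, next => .arith op dst a b next
  | readInput dst addr, next => .readInput dst addr next

variable [DecidableEq R]

/-- The effect on the registers. -/
def exec (x : List Bool) (ρ : R → ℕ) : Flat R → R → ℕ
  | const dst v => Function.update ρ dst v
  | arith op dst a b => Function.update ρ dst (op.eval (ρ a) (ρ b))
  | readInput dst addr => Function.update ρ dst (symbolValue x[ρ addr]?)

/-- The effect of a list of instructions on the registers. -/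
def execs (x : List Bool) (l : List (Flat R)) (ρ : R → ℕ) : R → ℕ :=
  l.foldl (exec x) ρ

/-- The property `P` holds before and after each instruction of the list. -/
def Always (P : (R → ℕ) → Prop) (x : List Bool) : List (Flat R) → (R → ℕ) → Prop
  | [], ρ => P ρ
  | i :: l, ρ => P ρ ∧ Always P x l (exec x ρ i)

theorem Always.append {P : (R → ℕ) → Prop} {x : List Bool} {l₁ l₂ : List (Flat R)} {ρ : R → ℕ}
    (h₁ : Always P x l₁ ρ) (h₂ : Always P x l₂ (execs x l₁ ρ)) : Always P x (l₁ ++ l₂) ρ := by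
  induction l₁ generalizing ρ with
  | nil => exact h₂
  | cons i l ih => exact ⟨h₁.1, ih h₁.2 h₂⟩

theorem Always.take {P : (R → ℕ) → Prop} {x : List Bool} {l : List (Flat R)} {ρ : R → ℕ}
    (h : Always P x l ρ) (j : ℕ) : P (execs x (l.take j) ρ) := by
  induction l generalizing ρ j with
  | nil => simpa [execs, Always] using h
  | cons i l ih =>
      cases j with
      | zero => exact h.1
      | succ j => exact ih h.2 j

theorem Always.last {P : (R → ℕ) → Prop} {x : List Bool} {l : List (Flat R)} {ρ : R → ℕ}
    (h : Always P x l ρ) : P (execs x l ρ) := by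
  simpa using h.take l.length

theorem execs_append (x : List Bool) (l₁ l₂ : List (Flat R)) (ρ : R → ℕ) :
    execs x (l₁ ++ l₂) ρ = execs x l₂ (execs x l₁ ρ) := List.foldl_append

end Flat

/-- The `j`-th of `D + 1` temporary registers. -/
def temp {R : Type} (D j : ℕ) : R ⊕ Fin (D + 1) := Sum.inr (Fin.ofNat (D + 1) j)

theorem temp_ne {R : Type} {D i j : ℕ} (hij : i < j) (hj : j ≤ D) :
    (temp D i : R ⊕ Fin (D + 1)) ≠ temp D j := by
  intro h
  have := congrArg Fin.val (Sum.inr_injective h)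
  simp only [Fin.val_ofNat] at this
  rw [Nat.mod_eq_of_lt (by omega), Nat.mod_eq_of_lt (by omega)] at this
  omega

/-- Straight-line code that puts the value of an expression into the temporary register `d`,
using only that one and the following ones. -/
def Expr.flatten {R : Type} (D : ℕ) : Expr R → ℕ → List (Flat (R ⊕ Fin (D + 1)))
  | .var r, d => [.const (temp D d) 0, .arith .add (temp D d) (Sum.inl r) (temp D d)]
  | .const v, d => [.const (temp D d) v]
  | .op o a b, d =>
      a.flatten D d ++ b.flatten D (d + 1) ++ [.arith o (temp D d) (temp D d) (temp D (d + 1))]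
  | .read a, d => a.flatten D d ++ [.readInput (temp D d) (temp D d)]

/-- The register contents during the evaluation of an expression: the program registers contain
`σ`, and the temporary registers contain numbers of at most `W` bits. -/
def Evaluating {R : Type} (D W : ℕ) (σ : R → ℕ) (ρ : R ⊕ Fin (D + 1) → ℕ) : Prop :=
  (∀ r, ρ (Sum.inl r) = σ r) ∧ ∀ j, Nat.size (ρ (Sum.inr j)) ≤ W

theorem Evaluating.update {R : Type} [DecidableEq R] {D W : ℕ} {σ : R → ℕ}
    {ρ : R ⊕ Fin (D + 1) → ℕ} (h : Evaluating D W σ ρ) (d : ℕ) {v : ℕ} (hv : Nat.size v ≤ W) :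
    Evaluating D W σ (Function.update ρ (temp D d) v) := by
  refine ⟨fun r => ?_, fun j => ?_⟩
  · rw [Function.update_of_ne (by simp [temp])]
    exact h.1 r
  · by_cases hj : (Sum.inr j : R ⊕ Fin (D + 1)) = temp D d
    · rw [hj, Function.update_self]
      exact hv
    · rw [Function.update_of_ne hj]
      exact h.2 j

/-- The code of an expression computes its value, changes no program register and no temporary
register below `d`, and keeps all temporary registers short. -/
theorem Expr.execs_flatten {R : Type} [DecidableEq R] {D B W : ℕ} (x : List Bool) (σ : R → ℕ)
    (hσ : ∀ r, Nat.size (σ r) ≤ B) (e : Expr R) (d : ℕ) (hd : d + e.depth ≤ D)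
    (hW : e.weight * (B + 1) ≤ W) (ρ : R ⊕ Fin (D + 1) → ℕ) (hρ : Evaluating D W σ ρ) :
    Flat.Always (Evaluating D W σ) x (e.flatten D d) ρ ∧
      Flat.execs x (e.flatten D d) ρ (temp D d) = e.eval x σ ∧
      ∀ j < d, Flat.execs x (e.flatten D d) ρ (temp D j) = ρ (temp D j) := by
  have hsize := (e.size_eval_le x σ B hσ).trans hW
  induction e generalizing d ρ with
  | var r =>
      have h0 := hρ.update d (v := 0) (by simp)
      refine ⟨⟨hρ, h0, ?_⟩, ?_, fun j hj => ?_⟩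
      · refine h0.update d ?_
        simp only [Flat.exec, Function.update_self, h0.1]
        simpa [ArithOp.eval, eval] using hsize
      · simp only [flatten, Flat.execs, List.foldl, Flat.exec, Function.update_self, h0.1]
        simp [ArithOp.eval, eval]
      · simp only [flatten, Flat.execs, List.foldl, Flat.exec]
        rw [Function.update_of_ne (temp_ne hj (by omega)),
          Function.update_of_ne (temp_ne hj (by omega))]
  | const v =>
      refine ⟨⟨hρ, hρ.update d hsize⟩, ?_, fun j hj => ?_⟩
      · simp [flatten, Flat.execs, Flat.exec, eval]
      · simp only [flatten, Flat.execs, List.foldl, Flat.exec]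
        rw [Function.update_of_ne (temp_ne hj (by omega))]
  | op o a b iha ihb =>
      simp only [depth, weight, add_mul] at hd hW
      have hda : d + a.depth ≤ D := by omega
      have hdb : d + 1 + b.depth ≤ D := by omega
      obtain ⟨a1, a2, a3⟩ := iha d hda (by omega) ρ hρ
        ((a.size_eval_le x σ B hσ).trans (by omega))
      obtain ⟨b1, b2, b3⟩ := ihb (d + 1) hdb (by omega) _ a1.last
        ((b.size_eval_le x σ B hσ).trans (by omega))
      have hv : ∀ v, v = Flat.execs x (b.flatten D (d + 1)) (Flat.execs x (a.flatten D d) ρ) →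
          o.eval (v (temp D d)) (v (temp D (d + 1))) = (Expr.op o a b).eval x σ := by
        rintro _ rfl
        rw [b2, b3 d (by omega), a2, eval]
      refine ⟨(a1.append b1).append ?_, ?_, fun j hj => ?_⟩
      · rw [Flat.execs_append]
        refine ⟨b1.last, b1.last.update d ?_⟩
        rw [hv _ rfl]
        exact hsize
      · rw [flatten, Flat.execs_append, Flat.execs_append]
        simp only [Flat.execs, List.foldl, Flat.exec, Function.update_self]
        exact hv _ rfl
      · rw [flatten, Flat.execs_append, Flat.execs_append]
        refine (Function.update_of_ne (temp_ne hj (by omega)) _ _).trans ?_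
        rw [b3 j (by omega), a3 j hj]
  | read a iha =>
      simp only [depth, weight, add_mul] at hd hW
      obtain ⟨a1, a2, a3⟩ := iha d hd (by omega) ρ hρ
        ((a.size_eval_le x σ B hσ).trans (by omega))
      refine ⟨a1.append ⟨a1.last, a1.last.update d ?_⟩, ?_, fun j hj => ?_⟩
      · rw [a2]
        exact hsize
      · rw [flatten, Flat.execs_append]
        simp only [Flat.execs, List.foldl, Flat.exec, Function.update_self]
        rw [← Flat.execs, a2, eval]
      · rw [flatten, Flat.execs_append]
        refine (Function.update_of_ne (temp_ne hj (by omega)) _ _).trans ?_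
        rw [a3 j hj]

/-- The commands of a program: those of a machine, except that values are computed by
expressions, and that there is no multiple access random string. -/
inductive Cmd (Q R : Type)
  /-- `dst := e` -/
  | assign (dst : R) (e : Expr R) (next : Q)
  /-- go to `yes` if the value of `e` is positive, and to `no` otherwise -/
  | branch (e : Expr R) (yes no : Q)
  | readWork (dst addr : R) (next : Q)
  | writeWork (addr src : R) (next : Q)
  | readOnce (dst : R) (next : Q)
  | halt (b : Bool)

/-- The expression that is evaluated by a command (a dummy if there is none). -/
def Cmd.expr {Q R : Type} : Cmd Q R → Expr R
  | assign _ e _ => e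
  | branch e _ _ => e
  | _ => .const 0

/-- The effect of a command on a configuration. -/
def Cmd.act {Q R : Type} [DecidableEq R] (x : List Bool) (ro : ℕ → Bool) (c : Config Q R) :
    Cmd Q R → Config Q R
  | .assign dst e next =>
      { c with state := next, reg := Function.update c.reg dst (e.eval x c.reg) }
  | .branch e yes no => { c with state := if 0 < e.eval x c.reg then yes else no }
  | .readWork dst addr next =>
      { c with
        state := next
        reg := Function.update c.reg dst (c.work (c.reg addr)).toNat }
  | .writeWork addr src next =>
      { c with
        state := next
        work := Function.update c.work (c.reg addr) (decide (c.reg src ≠ 0)) }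
  | .readOnce dst next =>
      { c with
        state := next
        reg := Function.update c.reg dst (ro c.used).toNat
        used := c.used + 1 }
  | .halt _ => c

/-- A machine whose instructions are commands. -/
structure Program where
  State : Type
  Reg : Type
  [stateFintype : Fintype State]
  [regFintype : Fintype Reg]
  [regDecidableEq : DecidableEq Reg]
  start : State
  code : State → Cmd State Reg

attribute [instance] Program.stateFintype Program.regFintype Program.regDecidableEq

namespace Program

variable (P : Program)

/-- The execution of one command. -/
def step (x : List Bool) (ro : ℕ → Bool) (c : Config P.State P.Reg) : Config P.State P.Reg :=
  (P.code c.state).act x ro c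

/-- The configuration in which a computation starts. -/
def startConfig : Config P.State P.Reg where
  state := P.start
  reg := fun _ => 0
  work := fun _ => false
  used := 0

/-- The configuration after the execution of `t` commands. -/
def run (x : List Bool) (ro : ℕ → Bool) (t : ℕ) : Config P.State P.Reg :=
  (P.step x ro)^[t] P.startConfig

/-- The number of temporary registers, minus one, of the compiled machine. -/
def tempBound : ℕ := (Finset.univ.sup fun q => (P.code q).expr.depth) + 1

/-- The code that evaluates the expression of a command, the result being in the temporary
register `0`, and then clears the temporary register `1`. -/
def prelude (q : P.State) : List (Flat (P.Reg ⊕ Fin (P.tempBound + 1))) :=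
  (P.code q).expr.flatten P.tempBound 0 ++ [.const (temp P.tempBound 1) 0]

/-- The state of the compiled machine at the beginning of a command. -/
def entry (q : P.State) : Σ q : P.State, Fin ((P.prelude q).length + 1) := ⟨q, 0⟩

/-- The instruction that completes a command after its expression has been evaluated. -/
def finish : Cmd P.State P.Reg →
    Instr (Σ q : P.State, Fin ((P.prelude q).length + 1)) (P.Reg ⊕ Fin (P.tempBound + 1))
  | .assign dst _ next =>
      .arith .add (Sum.inl dst) (temp P.tempBound 0) (temp P.tempBound 1) (P.entry next)
  | .branch _ yes no =>
      .branch (temp P.tempBound 1) (temp P.tempBound 0) (P.entry yes) (P.entry no)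
  | .readWork dst addr next => .readWork (Sum.inl dst) (Sum.inl addr) (P.entry next)
  | .writeWork addr src next => .writeWork (Sum.inl addr) (Sum.inl src) (P.entry next)
  | .readOnce dst next => .readOnce (Sum.inl dst) (P.entry next)
  | .halt b => .halt b

/-- The machine that carries out the program. Its states are the states of the program, together
with a position in the code of the command. -/
abbrev compile : Machine where
  State := Σ q : P.State, Fin ((P.prelude q).length + 1)
  Reg := P.Reg ⊕ Fin (P.tempBound + 1)
  start := P.entry P.start
  code := fun p =>
    if h : p.2.val < (P.prelude p.1).length then
      ((P.prelude p.1)[p.2.val]).toInstr ⟨p.1, ⟨p.2.val + 1, Nat.succ_lt_succ h⟩⟩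
    else P.finish (P.code p.1)

theorem compile_noMultipleAccess : P.compile.NoMultipleAccess := by
  intro p dst addr next h
  simp only [compile] at h
  split_ifs at h with hp
  · cases hi : (P.prelude p.1)[p.2.val] <;> rw [hi] at h <;> cases h
  · cases hc : P.code p.1 <;> rw [hc] at h <;> cases h

/-- The compiled machine in configuration `d` is about to execute the next command of the
program in configuration `c`. -/
structure Matches (W : ℕ) (c : Config P.State P.Reg)
    (d : Config P.compile.State P.compile.Reg) : Prop where
  state : d.state = P.entry c.state
  reg : Evaluating P.tempBound W c.reg d.reg
  work : d.work = c.work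
  used : d.used = c.used

/-- All numbers have at most `B` bits, and the work tape is blank from position `B` on. -/
def Fits {Q R : Type} (B : ℕ) (c : Config Q R) : Prop :=
  (∀ r, Nat.size (c.reg r) ≤ B) ∧ ∀ i, B ≤ i → c.work i = false

/-- The bound on the space of a configuration of the compiled machine. -/
def Bounded (B W : ℕ) (d : Config P.compile.State P.compile.Reg) : Prop :=
  ∃ c : Config P.State P.Reg, Fits B c ∧ Evaluating P.tempBound W c.reg d.reg ∧ d.work = c.work

/-- The prelude of a command leaves the value of the expression in the temporary register `0`, and
`0` in the temporary register `1`. -/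
theorem prelude_spec {B W : ℕ} (x : List Bool) (q : P.State) (σ : P.Reg → ℕ)
    (hσ : ∀ r, Nat.size (σ r) ≤ B) (hW : (P.code q).expr.weight * (B + 1) ≤ W)
    (ρ : P.Reg ⊕ Fin (P.tempBound + 1) → ℕ) (hρ : Evaluating P.tempBound W σ ρ) :
    Flat.Always (Evaluating P.tempBound W σ) x (P.prelude q) ρ ∧
      Flat.execs x (P.prelude q) ρ (temp P.tempBound 0) = (P.code q).expr.eval x σ ∧
      Flat.execs x (P.prelude q) ρ (temp P.tempBound 1) = 0 := by
  have hd : (P.code q).expr.depth ≤ Finset.univ.sup fun q => (P.code q).expr.depth :=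
    Finset.le_sup (f := fun q => (P.code q).expr.depth) (Finset.mem_univ q)
  obtain ⟨h1, h2, -⟩ := (P.code q).expr.execs_flatten (D := P.tempBound) x σ hσ 0
    (by simp only [tempBound]; omega) hW ρ hρ
  refine ⟨h1.append ⟨h1.last, h1.last.update 1 (by simp)⟩, ?_, ?_⟩
  · rw [prelude, Flat.execs_append]
    exact (Function.update_of_ne (temp_ne one_pos (by simp [tempBound])) 0 _).trans h2
  · rw [prelude, Flat.execs_append]
    exact Function.update_self (β := fun _ => ℕ) (temp (R := P.Reg) P.tempBound 1) 0
      (Flat.execs x ((P.code q).expr.flatten P.tempBound 0) ρ)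

/-- The first `j` steps of a command execute the first `j` instructions of its prelude. -/
theorem compile_step_prelude (x : List Bool) (ro ma : ℕ → Bool)
    (d : Config P.compile.State P.compile.Reg) (q : P.State) (hd : d.state = P.entry q) (j : ℕ)
    (hj : j ≤ (P.prelude q).length) :
    (P.compile.step x ro ma)^[j] d =
      { d with
        state := (⟨q, ⟨j, Nat.lt_succ_of_le hj⟩⟩ : Σ q : P.State, Fin ((P.prelude q).length + 1))
        reg := Flat.execs x ((P.prelude q).take j) d.reg } := by
  induction j with
  | zero =>
      obtain ⟨s, r, w, u⟩ := d
      cases hd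
      rfl
  | succ j ih =>
      rw [Function.iterate_succ_apply', ih (by omega), List.take_succ_eq_append_getElem (by omega),
        Flat.execs_append]
      have hcode : P.compile.code ⟨q, ⟨j, by omega⟩⟩ = ((P.prelude q)[j]).toInstr
          (⟨q, ⟨j + 1, by omega⟩⟩ : Σ q : P.State, Fin ((P.prelude q).length + 1)) :=
        dif_pos (show j < (P.prelude q).length by omega)
      refine (P.compile.step_eq x ro ma hcode).trans ?_
      cases (P.prelude q)[j] <;> rfl

/-- The compiled machine executes one command of the program: the space is bounded meanwhile, the
machine halts if the command says so, and otherwise it reaches the beginning of the next command. -/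
theorem compile_step_command {B W : ℕ} (x : List Bool) (ro ma : ℕ → Bool)
    (hW : ∀ q, (P.code q).expr.weight * (B + 1) ≤ W)
    (c : Config P.State P.Reg) (d : Config P.compile.State P.compile.Reg)
    (hm : P.Matches W c d) (hc : Fits B c) :
    (∀ j ≤ (P.prelude c.state).length, P.Bounded B W ((P.compile.step x ro ma)^[j] d)) ∧
    (∀ b, P.code c.state = .halt b →
      P.compile.code ((P.compile.step x ro ma)^[(P.prelude c.state).length] d).state = .halt b) ∧
    ((∀ b, P.code c.state ≠ .halt b) →
      P.Matches W (P.step x ro c)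
        ((P.compile.step x ro ma)^[(P.prelude c.state).length + 1] d)) := by
  obtain ⟨h1, h2, h3⟩ := P.prelude_spec x c.state c.reg hc.1 (hW _) d.reg hm.reg
  have hrun := P.compile_step_prelude x ro ma d c.state hm.state
  have hfin : P.compile.code ⟨c.state, ⟨(P.prelude c.state).length, Nat.lt_succ_self _⟩⟩ =
      P.finish (P.code c.state) := dif_neg (lt_irrefl _)
  refine ⟨fun j hj => ?_, fun b hb => ?_, fun hne => ?_⟩
  · rw [hrun j hj]
    exact ⟨c, hc, h1.take j, hm.work⟩
  · rw [hrun _ le_rfl]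
    refine hfin.trans ?_
    rw [hb]
    rfl
  · rw [Function.iterate_succ_apply', hrun _ le_rfl, List.take_length]
    have hlast := h1.last
    set ρ := Flat.execs x (P.prelude c.state) d.reg with hρ
    have hupd : ∀ dst v, Evaluating P.tempBound W (Function.update c.reg dst v)
        (Function.update ρ (Sum.inl dst) v) := by
      refine fun dst v => ⟨fun r => ?_, fun j => ?_⟩
      · by_cases hr : r = dst
        · subst hr
          rw [Function.update_self, Function.update_self]
        · rw [Function.update_of_ne hr, Function.update_of_ne (by simpa using hr)]
          exact hlast.1 r
      · rw [Function.update_of_ne (by simp)]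
        exact hlast.2 j
    rw [P.compile.step_eq x ro ma hfin, step]
    cases hcode : P.code c.state with
    | assign dst e next =>
        rw [hcode] at h2
        refine ⟨rfl, ?_, hm.work, hm.used⟩
        have hv : ArithOp.add.eval (ρ (temp P.tempBound 0)) (ρ (temp P.tempBound 1)) =
            e.eval x c.reg := by
          rw [h2, h3]
          rfl
        change Evaluating _ W (Function.update c.reg dst (e.eval x c.reg))
          (Function.update ρ (Sum.inl dst) (ArithOp.add.eval _ _))
        rw [hv]
        exact hupd _ _
    | branch e yes no =>
        rw [hcode] at h2
        refine ⟨?_, hlast, hm.work, hm.used⟩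
        simp only [finish, Instr.act, Cmd.act, h2, h3, Cmd.expr]
        split_ifs <;> rfl
    | readWork dst addr next =>
        refine ⟨rfl, ?_, hm.work, hm.used⟩
        simp only [finish, Instr.act, Cmd.act, hlast.1, hm.work]
        exact hupd _ _
    | writeWork addr src next =>
        refine ⟨rfl, hlast, ?_, hm.used⟩
        simp only [finish, Instr.act, Cmd.act, hlast.1, hm.work]
    | readOnce dst next =>
        refine ⟨rfl, ?_, hm.work, ?_⟩
        · simp only [finish, Instr.act, Cmd.act, hm.used]
          exact hupd _ _
        · simp only [finish, Instr.act, Cmd.act, hm.used]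
    | halt b => exact absurd hcode (hne b)

end Program

theorem Machine.step_of_halt (M : Machine) (x : List Bool) (ro ma : ℕ → Bool)
    {c : Config M.State M.Reg} {b : Bool} (h : M.code c.state = .halt b) (t : ℕ) :
    (M.step x ro ma)^[t] c = c := by
  have h1 : M.step x ro ma c = c := M.step_eq x ro ma h
  exact Function.iterate_fixed h1 t

theorem Machine.run_add (M : Machine) (x : List Bool) (ro ma : ℕ → Bool) (t u : ℕ) :
    M.run x ro ma (t + u) = (M.step x ro ma)^[u] (M.run x ro ma t) := by
  rw [Machine.run, Machine.run, add_comm, Function.iterate_add_apply]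

theorem Machine.run_eq_of_halt (M : Machine) {x : List Bool} {ro ma : ℕ → Bool} {b : Bool}
    {t u : ℕ} (h : M.OutputsWithin x ro ma b t) (htu : t ≤ u) :
    M.run x ro ma u = M.run x ro ma t := by
  obtain ⟨v, rfl⟩ := Nat.exists_eq_add_of_le htu
  rw [Machine.run_add]
  exact M.step_of_halt x ro ma h v

theorem Machine.OutputsWithin.mono {M : Machine} {x : List Bool} {ro ma : ℕ → Bool} {b : Bool}
    {t u : ℕ} (h : M.OutputsWithin x ro ma b t) (htu : t ≤ u) : M.OutputsWithin x ro ma b u := by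
  rw [Machine.OutputsWithin, M.run_eq_of_halt h htu]
  exact h

theorem Machine.Outputs.unique {M : Machine} {x : List Bool} {ro ma : ℕ → Bool} {b b' : Bool}
    (h : M.Outputs x ro ma b) (h' : M.Outputs x ro ma b') : b = b' := by
  obtain ⟨t, ht⟩ := h
  obtain ⟨u, hu⟩ := h'
  have h1 := ht.mono (le_max_left t u)
  have h2 := hu.mono (le_max_right t u)
  rw [Machine.OutputsWithin] at h1 h2
  rw [h1] at h2
  exact Instr.halt.inj h2

namespace Program

variable (P : Program)

theorem run_succ (x : List Bool) (ro : ℕ → Bool) (t : ℕ) :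
    P.run x ro (t + 1) = P.step x ro (P.run x ro t) := Function.iterate_succ_apply' _ _ _

/-- As long as the program does not halt, the compiled machine follows it, with at most `L` steps
for each command. -/
theorem exists_matches {B W L : ℕ} (x : List Bool) (ro ma : ℕ → Bool)
    (hW : ∀ q, (P.code q).expr.weight * (B + 1) ≤ W) (hL : ∀ q, (P.prelude q).length + 1 ≤ L)
    (hfit : ∀ t, Fits B (P.run x ro t)) (T : ℕ)
    (hT : ∀ t < T, ∀ b, P.code (P.run x ro t).state ≠ .halt b) :
    ∃ τ ≤ L * T, P.Matches W (P.run x ro T) (P.compile.run x ro ma τ) ∧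
      ∀ t < τ, P.Bounded B W (P.compile.run x ro ma t) := by
  induction T with
  | zero =>
      exact ⟨0, by simp, ⟨rfl, ⟨fun _ => rfl, fun _ => by simp [Machine.run, Machine.startConfig]⟩,
        rfl, rfl⟩, by simp⟩
  | succ T ih =>
      obtain ⟨τ, hτ, hm, hb⟩ := ih fun t ht => hT t (by omega)
      obtain ⟨h1, -, h3⟩ := P.compile_step_command x ro ma hW _ _ hm (hfit T)
      refine ⟨τ + ((P.prelude (P.run x ro T).state).length + 1), ?_, ?_, fun t ht => ?_⟩
      · have := hL (P.run x ro T).state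
        rw [mul_add, mul_one]
        omega
      · rw [run_succ, Machine.run_add]
        exact h3 (hT T (by omega))
      · rcases lt_or_ge t τ with h | h
        · exact hb t h
        · obtain ⟨j, rfl⟩ := Nat.exists_eq_add_of_le h
          rw [Machine.run_add]
          exact h1 j (by omega)

theorem Bounded.spaceAtMost {P : Program} {B W : ℕ} {d : Config P.compile.State P.compile.Reg}
    (h : P.Bounded B W d) :
    Machine.SpaceAtMost d (Fintype.card P.Reg * B + (P.tempBound + 1) * W + B) := by
  obtain ⟨c, hc, hd, hw⟩ := h
  refine ⟨B, fun i hi => by rw [hw]; exact hc.2 i hi, Nat.add_le_add_right ?_ B⟩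
  refine (Fintype.sum_sum_type fun r : P.Reg ⊕ Fin (P.tempBound + 1) =>
    Nat.size (d.reg r)).trans_le (Nat.add_le_add ?_ ?_)
  · refine (Finset.sum_le_card_nsmul _ _ B fun r _ => ?_).trans (by simp)
    rw [hd.1 r]
    exact hc.1 r
  · exact (Finset.sum_le_card_nsmul _ _ W fun j _ => hd.2 j).trans (by simp)

/-- The compiled machine has the output of the program, and its resources exceed those of the
program by at most a constant factor. -/
theorem compile_spec : ∃ C : ℕ, ∀ (x : List Bool) (ro ma : ℕ → Bool) (B T : ℕ) (b : Bool),
    (∀ t, Fits B (P.run x ro t)) → P.code (P.run x ro T).state = .halt b →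
    P.compile.OutputsWithin x ro ma b (C * (T + 1)) ∧
      ∀ t, Machine.SpaceAtMost (P.compile.run x ro ma t) (C * (B + 1)) := by
  classical
  set L := Finset.univ.sup fun q => (P.prelude q).length + 1 with hL
  set w := Finset.univ.sup fun q => (P.code q).expr.weight with hw
  have hLq : ∀ q, (P.prelude q).length + 1 ≤ L := fun q =>
    Finset.le_sup (f := fun q => (P.prelude q).length + 1) (Finset.mem_univ q)
  have hwq : ∀ q, (P.code q).expr.weight ≤ w := fun q =>
    Finset.le_sup (f := fun q => (P.code q).expr.weight) (Finset.mem_univ q)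
  refine ⟨L + (Fintype.card P.Reg + (P.tempBound + 1) * w + 1), fun x ro ma B T b hfit hT => ?_⟩
  have hstay : ∀ t u b', P.code (P.run x ro t).state = .halt b' → t ≤ u →
      P.run x ro u = P.run x ro t := by
    intro t u b' h htu
    induction u, htu using Nat.le_induction with
    | base => rfl
    | succ u _ ih =>
        rw [run_succ, ih, step, h]
        rfl
  have hex : ∃ t b', P.code (P.run x ro t).state = .halt b' := ⟨T, b, hT⟩
  obtain ⟨b', hT₀⟩ := Nat.find_spec hex
  have hle : Nat.find hex ≤ T := Nat.find_min' hex ⟨b, hT⟩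
  set T₀ := Nat.find hex with hT₀_def
  have hb : b' = b := by
    rw [hstay T₀ T b' hT₀ hle, hT₀] at hT
    exact Cmd.halt.inj hT
  subst hb
  have hW : ∀ q, (P.code q).expr.weight * (B + 1) ≤ w * (B + 1) := fun q =>
    Nat.mul_le_mul_right _ (hwq q)
  obtain ⟨τ, hτ, hm, hbd⟩ := P.exists_matches x ro ma hW hLq hfit T₀ fun t ht b' hb' =>
    Nat.find_min hex ht ⟨b', hb'⟩
  obtain ⟨h1, h2, -⟩ := P.compile_step_command x ro ma hW _ _ hm (hfit T₀)
  have hout := h2 _ hT₀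
  rw [← Machine.run_add] at hout
  set len := (P.prelude (P.run x ro T₀).state).length with hlen
  have hlenL : len + 1 ≤ L := hLq _
  refine ⟨Machine.OutputsWithin.mono hout ?_, fun t => ?_⟩
  · have h3 : L * T₀ ≤ L * T := Nat.mul_le_mul_left L hle
    calc τ + len ≤ L * (T + 1) := by rw [mul_add]; omega
      _ ≤ _ := Nat.mul_le_mul_right _ (Nat.le_add_right _ _)
  · have hall : P.Bounded B (w * (B + 1)) (P.compile.run x ro ma t) := by
      rcases lt_or_ge t τ with h | h
      · exact hbd t h
      rcases le_or_gt t (τ + len) with h' | h'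
      · obtain ⟨j, rfl⟩ := Nat.exists_eq_add_of_le h
        rw [Machine.run_add]
        exact h1 j (by omega)
      · rw [Machine.run_eq_of_halt _ hout h'.le, Machine.run_add]
        exact h1 len le_rfl
    obtain ⟨u, hu, hsum⟩ := hall.spaceAtMost
    refine ⟨u, hu, hsum.trans ?_⟩
    have : Fintype.card P.Reg * B ≤ Fintype.card P.Reg * (B + 1) :=
      Nat.mul_le_mul_left _ (Nat.le_succ B)
    simp only [add_mul, one_mul, mul_assoc] at this ⊢
    have h4 : 0 ≤ L * (B + 1) := Nat.zero_le _
    omega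

end Program

/-! ### The simulated input and random string -/

/-- The number of consecutive ones of `x` from position `p` on. -/
def ones (x : List Bool) (p : ℕ) : ℕ := ((x.drop p).takeWhile id).length

theorem getElem?_of_lt_ones {x : List Bool} {p j : ℕ} (h : j < ones x p) :
    x[p + j]? = some true := by
  have hj := h
  rw [ones] at hj
  have h1 : ((x.drop p).takeWhile id)[j] = true := by
    have := List.mem_takeWhile_imp (List.getElem_mem hj)
    simpa using this
  rw [← List.getElem?_drop, ← List.takeWhile_append_dropWhile (p := id) (l := x.drop p),
    List.getElem?_append_left hj, List.getElem?_eq_getElem hj, h1]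

theorem getElem?_ones (x : List Bool) (p : ℕ) : x[p + ones x p]? ≠ some true := by
  rw [← List.getElem?_drop, ones]
  induction x.drop p with
  | nil => simp
  | cons a l ih =>
      cases a with
      | false => simp
      | true => simpa using ih

theorem ones_le (x : List Bool) (p : ℕ) : ones x p ≤ x.length :=
  ((List.takeWhile_prefix id).length_le).trans (by simp)

theorem ones_eq {x : List Bool} {p m : ℕ} (h : ∀ j < m, x[p + j]? = some true)
    (hm : x[p + m]? ≠ some true) : ones x p = m := by
  rcases lt_trichotomy (ones x p) m with h1 | h1 | h1
  · exact absurd (h _ h1) (getElem?_ones x p)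
  · exact h1
  · exact absurd (getElem?_of_lt_ones h1) hm

/-- The first number `n` that is encoded in the input. -/
def inputSize (x : List Bool) : ℕ := ones x 0

/-- The second number `k` that is encoded in the input. -/
def inputClique (x : List Bool) : ℕ := ones x (inputSize x + 1)

/-- The entry of the adjacency tensor that is encoded in the input, at the position `w`. -/
def tensorBit (x : List Bool) (w : List ℕ) : Bool :=
  decide (x[inputSize x + inputClique x + 2 + Nat.ofDigits (inputSize x) w]? = some true)

/-- The first `t` vertices together with the vertices `u` and `v` among the remaining ones. -/
def pairTuple (t u v : ℕ) : List ℕ := List.range t ++ [t + u, t + v]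

/-- The `t + 2` vertices that stand for the address `a` of a random bit. They are not among the
first `t` vertices; the `j`-th one is determined by the `j`-th digit of `a` in base `m` and by
its residue modulo `t + 2`. -/
def multiTuple (t m a : ℕ) : List ℕ :=
  (List.range (t + 2)).map fun j => t + ((t + 2) * (a / m ^ j % m) + j)

/-- The encoding of the graph on the vertices other than the first `t`, in which two vertices are
adjacent if they form a hyperedge together with the first `t` vertices. -/
def virtualInput (t : ℕ) (x : List Bool) : List Bool :=
  encodeNat (inputSize x - t) ++ encodeNat (inputClique x - t) ++
    List.ofFn fun q : Fin ((inputSize x - t) ^ 2) =>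
      if q.val % (inputSize x - t) = q.val / (inputSize x - t) % (inputSize x - t) then false
      else tensorBit x (pairTuple t (q.val % (inputSize x - t))
        (q.val / (inputSize x - t) % (inputSize x - t)))

/-- The string of random bits that is extracted from the hypergraph. -/
def virtualMulti (t : ℕ) (x : List Bool) (a : ℕ) : Bool :=
  tensorBit x (multiTuple t ((inputSize x - t) / (t + 2)) a)

theorem length_encodeNat (m : ℕ) : (encodeNat m).length = m + 1 := by
  simp [encodeNat]

theorem getElem?_encodeNat_append (m : ℕ) (l : List Bool) (p : ℕ) :
    (encodeNat m ++ l)[p]? =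
      if p < m then some true else if p < m + 1 then some false else l[p - (m + 1)]? := by
  rw [List.getElem?_append, length_encodeNat]
  simp only [encodeNat]
  split_ifs with h1 h2 h2
  · rw [List.getElem?_append_left (by simpa using h2)]
    simp [h2]
  · rw [List.getElem?_append_right (by simpa using h2)]
    have : p - m = 0 := by omega
    simp [this]
  · omega
  · rfl

theorem length_virtualInput_le (t : ℕ) (x : List Bool) :
    (virtualInput t x).length ≤ (x.length + 2) ^ 2 := by
  have h1 : inputSize x - t ≤ x.length := (Nat.sub_le _ _).trans (ones_le _ _)
  have h2 : inputClique x - t ≤ x.length := (Nat.sub_le _ _).trans (ones_le _ _)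
  simp only [virtualInput, List.length_append, length_encodeNat, List.length_ofFn]
  nlinarith

/-! ### Expressions for the simulation -/

namespace Expr

variable {R : Type}

/-- `1` if `0 < e`, and `0` otherwise -/
def sign (e : Expr R) : Expr R := op .sub (const 1) (op .sub (const 1) e)

/-- positive if and only if `a < b` -/
def lt (a b : Expr R) : Expr R := op .sub b a

/-- `a` if `0 < c`, and `b` otherwise -/
def cond (c a b : Expr R) : Expr R :=
  op .add (op .mul c.sign a) (op .mul (op .sub (const 1) c.sign) b)

/-- `1` if the input bit at the address `e` is a one, and `0` otherwise -/
def bit (e : Expr R) : Expr R := op .mod (read e) (const 2)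

/-- the number `e ^ j` -/
def pow (e : Expr R) : ℕ → Expr R
  | 0 => const 1
  | j + 1 => op .mul (pow e j) e

/-- the number with the digits `l` in base `b` -/
def ofDigits (b : Expr R) : List (Expr R) → Expr R
  | [] => const 0
  | d :: l => op .add d (op .mul b (ofDigits b l))

variable (x : List Bool) (ρ : R → ℕ)

theorem eval_lt (a b : Expr R) : 0 < (lt a b).eval x ρ ↔ a.eval x ρ < b.eval x ρ := by
  simp [lt, eval, ArithOp.eval]

theorem eval_cond (c a b : Expr R) :
    (cond c a b).eval x ρ = if 0 < c.eval x ρ then a.eval x ρ else b.eval x ρ := by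
  simp only [cond, sign, eval, ArithOp.eval]
  split_ifs with h
  · have : 1 - c.eval x ρ = 0 := by omega
    simp [this]
  · have : c.eval x ρ = 0 := by omega
    simp [this]

theorem eval_bit (e : Expr R) :
    (bit e).eval x ρ = (decide (x[e.eval x ρ]? = some true)).toNat := by
  simp only [bit, eval, ArithOp.eval]
  rcases x[e.eval x ρ]? with _ | _ | _ <;> simp [symbolValue]

theorem eval_pow (e : Expr R) (j : ℕ) : (pow e j).eval x ρ = e.eval x ρ ^ j := by
  induction j with
  | zero => rfl
  | succ j ih => rw [pow, eval, ArithOp.eval, ih, pow_succ]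

theorem eval_ofDigits (b : Expr R) (l : List (Expr R)) :
    (ofDigits b l).eval x ρ = Nat.ofDigits (b.eval x ρ) (l.map (eval x ρ)) := by
  induction l with
  | nil => rfl
  | cons d l ih =>
      rw [ofDigits, eval, eval, ArithOp.eval, ArithOp.eval, ih, List.map_cons, Nat.ofDigits_cons]

end Expr

/-- The registers of the simulation: those of the simulated machine, and two registers for the
numbers `n` (`false`) and `k` (`true`). -/
abbrev SimReg (R : Type) : Type := R ⊕ Bool

/-- The contents of the registers in the simulation. -/
def simReg {R : Type} (n k : ℕ) (ρ : R → ℕ) : SimReg R → ℕ :=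
  Sum.elim ρ fun i => if i then k else n

section SimExpr

variable {R : Type}

open PlantedClique.Expr

/-- The number of vertices of the simulated graph. -/
def simSize (t : ℕ) : Expr (SimReg R) := op .sub (var (Sum.inr false)) (const t)

/-- The clique size of the simulated graph. -/
def simClique (t : ℕ) : Expr (SimReg R) := op .sub (var (Sum.inr true)) (const t)

/-- Access to the adjacency tensor. -/
def simTensor (w : List (Expr (SimReg R))) : Expr (SimReg R) :=
  bit (op .add (op .add (op .add (var (Sum.inr false)) (var (Sum.inr true))) (const 2))
    (ofDigits (var (Sum.inr false)) w))

/-- The simulation of reading the input at the address `p`. -/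
def simInput (t : ℕ) (p : Expr (SimReg R)) : Expr (SimReg R) :=
  let n := simSize t
  let k := simClique t
  let n' := op .add n (const 1)
  let k' := op .add k (const 1)
  let p' := op .sub p n'
  let q := op .sub p' k'
  let u := op .mod q n
  let v := op .mod (op .div q n) n
  cond (lt p n) (const 1) <| cond (lt p n') (const 0) <|
  cond (lt p' k) (const 1) <| cond (lt p' k') (const 0) <|
  cond (lt q (op .mul n n))
    (cond (op .add (lt u v) (lt v u))
      (simTensor ((List.range t).map const ++ [op .add (const t) u, op .add (const t) v]))
      (const 0))
    (const 2)

/-- The simulation of reading the multiple access random string at the address `a`. -/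
def simMulti (t : ℕ) (a : Expr (SimReg R)) : Expr (SimReg R) :=
  let m := op .div (simSize t) (const (t + 2))
  simTensor ((List.range (t + 2)).map fun j =>
    op .add (const t) (op .add
      (op .mul (const (t + 2)) (op .mod (op .div a (pow m j)) m)) (const j)))

variable (x : List Bool) (ρ : R → ℕ)

local notation "regs" => simReg (inputSize x) (inputClique x) ρ

theorem eval_simTensor (w : List (Expr (SimReg R))) :
    (simTensor w).eval x regs = (tensorBit x (w.map (Expr.eval x regs))).toNat := by
  rw [simTensor, eval_bit, tensorBit]
  simp only [eval, ArithOp.eval, eval_ofDigits]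
  rfl

theorem eval_simMulti (t : ℕ) (a : Expr (SimReg R)) :
    (simMulti t a).eval x regs = (virtualMulti t x (a.eval x regs)).toNat := by
  rw [simMulti, eval_simTensor, virtualMulti, multiTuple, List.map_map]
  congr 3
  funext j
  simp only [Function.comp, eval, ArithOp.eval, eval_pow, simSize]
  rfl

theorem eval_simInput (t : ℕ) (p : Expr (SimReg R)) :
    (simInput t p).eval x regs = symbolValue (virtualInput t x)[p.eval x regs]? := by
  have hn : (simSize t).eval x regs = inputSize x - t := rfl
  have hk : (simClique t).eval x regs = inputClique x - t := rfl
  rw [virtualInput, List.append_assoc, getElem?_encodeNat_append, getElem?_encodeNat_append]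
  simp only [simInput, eval_cond, eval_lt, eval_simTensor, eval, ArithOp.eval, hn, hk,
    List.map_append, List.map_map, List.map_cons, List.map_nil]
  simp only [Expr.lt, eval, ArithOp.eval, hn, hk]
  set n := inputSize x - t
  set k := inputClique x - t
  set a := p.eval x regs
  set q := a - (n + 1) - (k + 1)
  have hmap : (List.range t).map (eval x regs ∘ Expr.const) = List.range t :=
    List.map_id (List.range t)
  split_ifs with h1 h2 h3 h4 h5 h6
  · rfl
  · rfl
  · rfl
  · rfl
  · rw [List.getElem?_eq_getElem (by simpa [sq] using h5), List.getElem_ofFn,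
      if_neg (show ¬ q % n = q / n % n by omega), hmap]
    rfl
  · rw [List.getElem?_eq_getElem (by simpa [sq] using h5), List.getElem_ofFn,
      if_pos (show q % n = q / n % n by omega)]
    rfl
  · rw [List.getElem?_eq_none (by simpa [sq] using h5)]
    rfl

end SimExpr

/-! ### The simulating program -/

/-- The states of the simulation: those in which the number `n` (`false`) or `k` (`true`) is
read, where the second component tells whether a one has been found, and the states of the
simulated machine. -/
abbrev SimState (Q : Type) : Type := (Bool × Bool) ⊕ Q

/-- The command that simulates an instruction. -/
def simCmd {Q R : Type} (t : ℕ) : Instr Q R → Cmd (SimState Q) (SimReg R)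
  | .const dst v next => .assign (Sum.inl dst) (.const v) (Sum.inr next)
  | .arith op dst a b next =>
      .assign (Sum.inl dst) (.op op (.var (Sum.inl a)) (.var (Sum.inl b))) (Sum.inr next)
  | .branch a b yes no =>
      .branch (.lt (.var (Sum.inl a)) (.var (Sum.inl b))) (Sum.inr yes) (Sum.inr no)
  | .readInput dst addr next =>
      .assign (Sum.inl dst) (simInput t (.var (Sum.inl addr))) (Sum.inr next)
  | .readWork dst addr next => .readWork (Sum.inl dst) (Sum.inl addr) (Sum.inr next)
  | .writeWork addr src next => .writeWork (Sum.inl addr) (Sum.inl src) (Sum.inr next)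
  | .readOnce dst next => .readOnce (Sum.inl dst) (Sum.inr next)
  | .readMulti dst addr next =>
      .assign (Sum.inl dst) (simMulti t (.var (Sum.inl addr))) (Sum.inr next)
  | .halt b => .halt b

/-- The address of the next symbol of the number that is being read. -/
def counterAddr {R : Type} : Bool → Expr (SimReg R)
  | false => .var (Sum.inr false)
  | true => .op .add (.op .add (.var (Sum.inr false)) (.const 1)) (.var (Sum.inr true))

variable (M : Machine) (t : ℕ)

/-- The program that determines the numbers `n` and `k` in its input and then simulates `M` on the
virtual input and the virtual multiple access random string. -/
abbrev simulation : Program where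
  State := SimState M.State
  Reg := SimReg M.Reg
  start := Sum.inl (false, false)
  code
    | Sum.inl (i, false) =>
        .branch (.bit (counterAddr i)) (Sum.inl (i, true))
          (if i then Sum.inr M.start else Sum.inl (true, false))
    | Sum.inl (i, true) =>
        .assign (Sum.inr i) (.op .add (.var (Sum.inr i)) (.const 1)) (Sum.inl (i, false))
    | Sum.inr q => simCmd t (M.code q)

/-- `P` gets from the configuration `c` to `c'` in `T` steps, and all earlier configurations
fit in `B` bits. -/
def Program.Reaches (P : Program) (x : List Bool) (ro : ℕ → Bool) (B : ℕ)
    (c : Config P.State P.Reg) (T : ℕ) (c' : Config P.State P.Reg) : Prop :=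
  (P.step x ro)^[T] c = c' ∧ ∀ j < T, Program.Fits B ((P.step x ro)^[j] c)

theorem Program.Reaches.refl (P : Program) (x : List Bool) (ro : ℕ → Bool) (B : ℕ)
    (c : Config P.State P.Reg) : P.Reaches x ro B c 0 c := ⟨rfl, by simp⟩

theorem Program.Reaches.step {P : Program} {x : List Bool} {ro : ℕ → Bool} {B : ℕ}
    {c c' : Config P.State P.Reg} {T : ℕ} (h : P.Reaches x ro B c T c') (hf : Fits B c') :
    P.Reaches x ro B c (T + 1) (P.step x ro c') := by
  refine ⟨by rw [Function.iterate_succ_apply', h.1], fun j hj => ?_⟩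
  rcases Nat.lt_succ_iff_lt_or_eq.1 hj with h' | rfl
  · exact h.2 j h'
  · rw [h.1]
    exact hf

/-- A configuration of the simulation before the simulated computation starts. -/
def countConfig (s : Bool × Bool) (n k : ℕ) : Config (SimState M.State) (SimReg M.Reg) where
  state := Sum.inl s
  reg := simReg n k fun _ => 0
  work := fun _ => false
  used := 0

theorem fits_countConfig {B n k : ℕ} (s : Bool × Bool) (hn : Nat.size n ≤ B)
    (hk : Nat.size k ≤ B) : Program.Fits B (countConfig M s n k) := by
  refine ⟨fun r => ?_, fun _ _ => rfl⟩
  rcases r with r | _ | _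
  · simp [countConfig, simReg]
  · simpa [countConfig, simReg] using hn
  · simpa [countConfig, simReg] using hk

/-- The configuration of the simulation that corresponds to a configuration of `M`. -/
def simConfig (n k : ℕ) (c : Config M.State M.Reg) :
    Config (SimState M.State) (SimReg M.Reg) where
  state := Sum.inr c.state
  reg := simReg n k c.reg
  work := c.work
  used := c.used

theorem update_simReg_inl {R : Type} [DecidableEq R] (n k : ℕ) (ρ : R → ℕ) (r : R) (v : ℕ) :
    Function.update (simReg n k ρ) (Sum.inl r) v = simReg n k (Function.update ρ r v) :=
  Sum.update_elim_inl

/-- One command of the simulation carries out one step of `M` on the virtual objects. -/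
theorem simulation_step (x : List Bool) (ro : ℕ → Bool) (c : Config M.State M.Reg) :
    (simulation M t).step x ro (simConfig M (inputSize x) (inputClique x) c) =
      simConfig M (inputSize x) (inputClique x)
        (M.step (virtualInput t x) ro (virtualMulti t x) c) := by
  rw [M.step_eq _ _ _ rfl]
  change Cmd.act x ro (simConfig M (inputSize x) (inputClique x) c) (simCmd t (M.code c.state)) = _
  have hI := eval_simInput x c.reg t
  have hM := eval_simMulti x c.reg t
  cases M.code c.state with
  | const dst v next =>
      simp only [simCmd, Cmd.act, Instr.act, simConfig, update_simReg_inl]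
      rfl
  | arith op dst a b next =>
      simp only [simCmd, Cmd.act, Instr.act, simConfig, update_simReg_inl]
      rfl
  | branch a b yes no =>
      simp only [simCmd, Cmd.act, Instr.act, simConfig, Expr.eval_lt]
      simp only [Expr.eval, simReg, Sum.elim_inl]
      split_ifs with h <;> simp [h]
  | readInput dst addr next =>
      simp only [simCmd, Cmd.act, Instr.act, simConfig, update_simReg_inl, hI]
      rfl
  | readWork dst addr next =>
      simp only [simCmd, Cmd.act, Instr.act, simConfig, update_simReg_inl]
      rfl
  | writeWork addr src next => rfl
  | readOnce dst next =>
      simp only [simCmd, Cmd.act, Instr.act, simConfig, update_simReg_inl]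
  | readMulti dst addr next =>
      simp only [simCmd, Cmd.act, Instr.act, simConfig, update_simReg_inl, hM]
      rfl
  | halt b => rfl

theorem simulation_step_test (x : List Bool) (ro : ℕ → Bool) (i : Bool) (n k : ℕ) :
    (simulation M t).step x ro (countConfig M (i, false) n k) =
      if x[if i then n + 1 + k else n]? = some true then countConfig M (i, true) n k
      else if i then simConfig M n k M.startConfig else countConfig M (true, false) n k := by
  change Cmd.act x ro (countConfig M (i, false) n k)
    (.branch (.bit (counterAddr i)) (Sum.inl (i, true))
          (if i then Sum.inr M.start else Sum.inl (true, false))) = _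
  have haddr : (counterAddr i).eval x (countConfig M (i, false) n k).reg =
      if i then n + 1 + k else n := by
    cases i <;> rfl
  simp only [Cmd.act, Expr.eval_bit, haddr]
  generalize x[if i then n + 1 + k else n]? = o
  by_cases h : o = some true
  · simp only [h, decide_true]
    rfl
  · simp only [h, decide_false]
    cases i <;> rfl

theorem simulation_step_count (x : List Bool) (ro : ℕ → Bool) (i : Bool) (n k : ℕ) :
    (simulation M t).step x ro (countConfig M (i, true) n k) =
      countConfig M (i, false) (if i then n else n + 1) (if i then k + 1 else k) := by
  change Cmd.act x ro (countConfig M (i, true) n k)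
    (.assign (Sum.inr i) (.op .add (.var (Sum.inr i)) (.const 1)) (Sum.inl (i, false))) = _
  simp only [Cmd.act, countConfig]
  congr 1
  funext r
  rcases r with r | _ | _ <;> cases i <;>
    simp [simReg, Function.update, Expr.eval, ArithOp.eval]

/-- The simulation determines the numbers `n` and `k` in linear time. -/
theorem simulation_reaches (x : List Bool) (ro : ℕ → Bool) (B : ℕ)
    (hB : Nat.size x.length ≤ B) :
    ∃ T ≤ 4 * x.length + 2, (simulation M t).Reaches x ro B (simulation M t).startConfig T
      (simConfig M (inputSize x) (inputClique x) M.startConfig) := by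
  have hsize : ∀ m p, m ≤ ones x p → Nat.size m ≤ B := fun m p h =>
    (Nat.size_le_size (h.trans (ones_le x p))).trans hB
  have h0 : (simulation M t).startConfig = countConfig M (false, false) 0 0 := by
    simp only [Program.startConfig, countConfig]
    congr 1
    funext r
    rcases r with r | _ | _ <;> rfl
  rw [h0]
  have h1 : ∀ j ≤ inputSize x, (simulation M t).Reaches x ro B (countConfig M (false, false) 0 0)
      (2 * j) (countConfig M (false, false) j 0) := by
    intro j
    induction j with
    | zero => exact fun _ => .refl _ _ _ _ _
    | succ j ih =>
        intro hj
        have hf : ∀ s, Program.Fits B (countConfig M s j 0) := fun s =>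
          fits_countConfig M s (hsize j 0 (by rw [← inputSize]; omega)) (by simp)
        have h2 := (ih (by omega)).step (hf _)
        have hx : x[j]? = some true := by
          simpa using getElem?_of_lt_ones (x := x) (p := 0) (j := j) hj
        rw [simulation_step_test, if_pos (by simpa using hx)] at h2
        have h3 := h2.step (hf _)
        rwa [simulation_step_count] at h3
  have h2 := (h1 _ le_rfl).step
    (fits_countConfig M _ (hsize (inputSize x) 0 le_rfl) (by simp))
  rw [simulation_step_test, if_neg (by simpa [inputSize] using getElem?_ones x 0)] at h2
  have h3 : ∀ j ≤ inputClique x, (simulation M t).Reaches x ro B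
      (countConfig M (false, false) 0 0)
      (2 * inputSize x + 1 + 2 * j) (countConfig M (true, false) (inputSize x) j) := by
    intro j
    induction j with
    | zero => exact fun _ => h2
    | succ j ih =>
        intro hj
        have hf : ∀ s, Program.Fits B (countConfig M s (inputSize x) j) := fun s =>
          fits_countConfig M s (hsize _ 0 le_rfl)
            (hsize j (inputSize x + 1) (by rw [← inputClique]; omega))
        have h2 := (ih (by omega)).step (hf _)
        have hx : x[inputSize x + 1 + j]? = some true := getElem?_of_lt_ones hj
        rw [simulation_step_test, if_pos (by simpa using hx)] at h2
        have h3 := h2.step (hf _)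
        rwa [simulation_step_count] at h3
  have h4 := (h3 _ le_rfl).step
    (fits_countConfig M _ (hsize (inputSize x) 0 le_rfl) (hsize _ (inputSize x + 1) le_rfl))
  rw [simulation_step_test,
    if_neg (by simpa [inputClique] using getElem?_ones x (inputSize x + 1))] at h4
  refine ⟨_, ?_, h4⟩
  have h5 : inputSize x ≤ x.length := ones_le _ _
  have h6 : inputClique x ≤ x.length := ones_le _ _
  omega

theorem simulation_iterate (x : List Bool) (ro : ℕ → Bool) (u : ℕ) :
    ((simulation M t).step x ro)^[u]
        (simConfig M (inputSize x) (inputClique x) M.startConfig) =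
      simConfig M (inputSize x) (inputClique x)
        (M.run (virtualInput t x) ro (virtualMulti t x) u) := by
  induction u with
  | zero => rfl
  | succ u ih =>
      rw [Function.iterate_succ_apply', ih, simulation_step,
        Machine.run, Machine.run, Function.iterate_succ_apply']

theorem fits_simConfig {B : ℕ} {x : List Bool} (hB : Nat.size x.length ≤ B)
    {c : Config M.State M.Reg} {B₀ : ℕ} (hc : Machine.SpaceAtMost c B₀) (hB₀ : B₀ ≤ B) :
    Program.Fits B (simConfig M (inputSize x) (inputClique x) c) := by
  have hsize : ∀ p, Nat.size (ones x p) ≤ B := fun p =>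
    (Nat.size_le_size (ones_le x p)).trans hB
  obtain ⟨u, hu, hsum⟩ := hc
  refine ⟨fun r => ?_, fun i hi => hu i (by omega)⟩
  rcases r with r | _ | _
  · have := Finset.single_le_sum (f := fun r => Nat.size (c.reg r)) (fun _ _ => Nat.zero_le _)
      (Finset.mem_univ r)
    change Nat.size (c.reg r) ≤ B
    omega
  · exact hsize 0
  · exact hsize _

theorem log_sq_le (l : ℕ) : Nat.log 2 ((l + 2) ^ 2) ≤ 2 * Nat.log 2 l + 3 := by
  have h1 : l < 2 ^ (Nat.log 2 l + 1) := Nat.lt_pow_succ_log_self one_lt_two l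
  have h2 : 2 ≤ 2 ^ (Nat.log 2 l + 1) := by
    rw [pow_succ]
    have := Nat.one_le_two_pow (n := Nat.log 2 l)
    omega
  have h3 : l + 2 < 2 ^ (Nat.log 2 l + 2) := by
    rw [pow_succ]
    omega
  have h4 : (l + 2) ^ 2 < 2 ^ (2 * Nat.log 2 l + 4) := by
    calc (l + 2) ^ 2 < (2 ^ (Nat.log 2 l + 2)) ^ 2 := Nat.pow_lt_pow_left h3 (by norm_num)
      _ = 2 ^ (2 * Nat.log 2 l + 4) := by rw [← pow_mul]; ring_nf
  have := Nat.log_lt_of_lt_pow (by positivity) h4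
  omega

theorem exists_pow_add_bound (a b : ℕ) :
    ∃ e₀, ∀ e ≥ e₀, ∀ l : ℕ, a * (l + 2) ^ b ≤ l ^ e + e := by
  refine ⟨a + 2 * b + a * 3 ^ b, fun e he l => ?_⟩
  rcases lt_or_ge l 2 with h | h
  · have : a * (l + 2) ^ b ≤ a * 3 ^ b :=
      Nat.mul_le_mul_left _ (Nat.pow_le_pow_left (by omega) _)
    omega
  · have h1 : l + 2 ≤ l ^ 2 := by nlinarith
    have h2 : a ≤ l ^ a := (Nat.lt_two_pow_self).le.trans (Nat.pow_le_pow_left h a)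
    calc a * (l + 2) ^ b ≤ l ^ a * (l ^ 2) ^ b :=
          Nat.mul_le_mul h2 (Nat.pow_le_pow_left h1 b)
      _ = l ^ (a + 2 * b) := by rw [← pow_mul, ← pow_add]
      _ ≤ l ^ e := Nat.pow_le_pow_right (by omega) (by omega)
      _ ≤ l ^ e + e := Nat.le_add_right _ _

/-- A multiple access randomized logspace algorithm is simulated, on the virtual input and the
virtual multiple access random string, by a randomized logspace algorithm. -/
theorem exists_simulating_machine (hM : M.IsMultipleAccessLogspace) :
    ∃ A : Machine, A.IsRandomizedLogspace ∧ ∀ x ro ma b,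
      A.Outputs x ro ma b ↔ M.Outputs (virtualInput t x) ro (virtualMulti t x) b := by
  obtain ⟨c, hc⟩ := hM
  obtain ⟨C, hC⟩ := (simulation M t).compile_spec
  -- the running time and the space of the compiled program, in terms of the length of the input
  have key : ∀ (x : List Bool) (ro ma : ℕ → Bool), ∃ b,
      M.Outputs (virtualInput t x) ro (virtualMulti t x) b ∧
      (simulation M t).compile.OutputsWithin x ro ma b
        (C * (c + 6) * (x.length + 2) ^ (2 * c + 1)) ∧
      ∀ u, Machine.SpaceAtMost ((simulation M t).compile.run x ro ma u)
        (C * (2 * c + 1) * Nat.log 2 x.length + C * (4 * c + 2)) := by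
    intro x ro ma
    obtain ⟨⟨b, hb⟩, hspace⟩ := hc (virtualInput t x) ro (virtualMulti t x)
    set B := c * (2 * Nat.log 2 x.length + 3) + c + (Nat.log 2 x.length + 1) with hBdef
    have hB : Nat.size x.length ≤ B := by
      have : Nat.size x.length ≤ Nat.log 2 x.length + 1 :=
        Nat.size_le.2 (Nat.lt_pow_succ_log_self one_lt_two _)
      omega
    have hB₀ : c * Nat.log 2 (virtualInput t x).length + c ≤ B := by
      have h1 : Nat.log 2 (virtualInput t x).length ≤ 2 * Nat.log 2 x.length + 3 :=
        (Nat.log_mono_right (length_virtualInput_le t x)).trans (log_sq_le _)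
      have := Nat.mul_le_mul_left c h1
      omega
    obtain ⟨T₀, hT₀, hreach, hfit₀⟩ := simulation_reaches M t x ro B hB
    have hrun : ∀ u, (simulation M t).run x ro (T₀ + u) =
        simConfig M (inputSize x) (inputClique x)
          (M.run (virtualInput t x) ro (virtualMulti t x) u) := by
      intro u
      rw [Program.run, add_comm, Function.iterate_add_apply, hreach, simulation_iterate]
    have hfit : ∀ u, Program.Fits B ((simulation M t).run x ro u) := by
      intro u
      rcases lt_or_ge u T₀ with h | h
      · exact hfit₀ u h
      · obtain ⟨v, rfl⟩ := Nat.exists_eq_add_of_le h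
        rw [hrun]
        exact fits_simConfig M hB (hspace v) hB₀
    have hhalt : (simulation M t).code ((simulation M t).run x ro
        (T₀ + ((virtualInput t x).length ^ c + c))).state = .halt b := by
      rw [hrun]
      change simCmd t (M.code (M.run _ _ _ _).state) = _
      rw [hb]
      rfl
    obtain ⟨h1, h2⟩ := hC x ro ma B _ b hfit hhalt
    refine ⟨b, ⟨_, hb⟩, h1.mono ?_, fun u => ?_⟩
    · rw [mul_assoc]
      refine Nat.mul_le_mul_left C ?_
      have h3 : (virtualInput t x).length ^ c ≤ (x.length + 2) ^ (2 * c) := by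
        rw [pow_mul]
        exact Nat.pow_le_pow_left (length_virtualInput_le t x) c
      have h6 : x.length + 2 ≤ (x.length + 2) ^ (2 * c + 1) :=
        Nat.le_self_pow (Nat.succ_ne_zero _) _
      have h7 : (x.length + 2) ^ (2 * c) ≤ (x.length + 2) ^ (2 * c + 1) :=
        Nat.pow_le_pow_right (Nat.succ_pos _) (Nat.le_succ _)
      have h8 : c * 1 ≤ c * (x.length + 2) ^ (2 * c + 1) :=
        Nat.mul_le_mul_left c (Nat.one_le_pow _ _ (Nat.succ_pos _))
      rw [add_mul]
      omega
    · obtain ⟨v, hv, hsum⟩ := h2 u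
      refine ⟨v, hv, hsum.trans (le_of_eq ?_)⟩
      rw [hBdef]
      ring
  obtain ⟨e₀, he₀⟩ := exists_pow_add_bound (C * (c + 6)) (2 * c + 1)
  refine ⟨(simulation M t).compile, ⟨⟨e₀ + C * (2 * c + 1) + C * (4 * c + 2), ?_⟩,
    (simulation M t).compile_noMultipleAccess⟩, fun x ro ma b => ?_⟩
  · intro x ro ma
    obtain ⟨b, -, h1, h2⟩ := key x ro ma
    refine ⟨⟨b, h1.mono (he₀ _ (by omega) _)⟩, fun u => ?_⟩
    obtain ⟨v, hv, hsum⟩ := h2 u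
    refine ⟨v, hv, hsum.trans ?_⟩
    exact Nat.add_le_add (Nat.mul_le_mul_right _ (by omega)) (by omega)
  · obtain ⟨b', h1, h2, -⟩ := key x ro ma
    constructor
    · intro h
      rwa [h.unique ⟨_, h2⟩]
    · intro h
      rw [h.unique h1]
      exact ⟨_, h2⟩

/-! ### Hyperedges that encode the graph and the random bits -/

section Edges

variable {n : ℕ} (t : ℕ)

/-- The first `t` vertices, together with the vertices of `K` shifted by `t`. -/
def extend (K : Finset (Fin n)) : Finset (Fin (t + n)) :=
  (Finset.univ.disjSum K).map (finSumFinEquiv (m := t) (n := n)).toEmbedding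

theorem card_extend (K : Finset (Fin n)) : (extend t K).card = t + K.card := by
  simp [extend]

theorem castAdd_mem_extend (K : Finset (Fin n)) (i : Fin t) : Fin.castAdd n i ∈ extend t K := by
  rw [extend, Finset.mem_map_equiv]
  simp

theorem natAdd_mem_extend (K : Finset (Fin n)) (v : Fin n) :
    Fin.natAdd t v ∈ extend t K ↔ v ∈ K := by
  rw [extend, Finset.mem_map_equiv]
  simp

theorem extend_subset_extend (K L : Finset (Fin n)) : extend t K ⊆ extend t L ↔ K ⊆ L := by
  constructor
  · intro h v hv
    exact (natAdd_mem_extend t L v).1 (h ((natAdd_mem_extend t K v).2 hv))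
  · intro h v
    refine Fin.addCases (fun i _ => castAdd_mem_extend t L i) (fun i hi => ?_) v
    exact (natAdd_mem_extend t L i).2 (h ((natAdd_mem_extend t K i).1 hi))

theorem extend_injective : Function.Injective (extend t : Finset (Fin n) → _) := by
  intro K L h
  exact ((extend_subset_extend t K L).1 h.le).antisymm ((extend_subset_extend t L K).1 h.ge)

/-- The vertices of `K`, shifted by `t`. -/
def shift (K : Finset (Fin n)) : Finset (Fin (t + n)) := K.map (Fin.natAddEmb t)

theorem shift_subset_extend (K L : Finset (Fin n)) : shift t K ⊆ extend t L ↔ K ⊆ L := by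
  simp only [shift, Finset.subset_iff, Finset.mem_map, forall_exists_index, and_imp,
    forall_apply_eq_imp_iff₂, Fin.natAddEmb_apply, natAdd_mem_extend]

/-- The vertices that correspond to an address, given by its `s` digits in base `n / s`. -/
def multiVertex (s : ℕ) (d : Fin s → Fin (n / s)) (j : Fin s) : Fin n :=
  ⟨s * (d j).val + j.val, by
    have h1 : s * ((d j).val + 1) ≤ s * (n / s) := Nat.mul_le_mul_left s (d j).isLt
    have h2 : s * (n / s) ≤ n := Nat.mul_div_le n s
    have h3 := j.isLt
    rw [mul_add] at h1
    omega⟩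

theorem multiVertex_inj {s : ℕ} {d d' : Fin s → Fin (n / s)} {i j : Fin s}
    (h : multiVertex s d i = multiVertex s d' j) : i = j ∧ d i = d' j := by
  have h1 : s * (d i).val + i.val = s * (d' j).val + j.val := congrArg Fin.val h
  have h2 : i.val = j.val := by
    have := congrArg (· % s) h1
    simpa [Nat.mod_eq_of_lt i.isLt, Nat.mod_eq_of_lt j.isLt] using this
  refine ⟨Fin.ext h2, Fin.ext ?_⟩
  rw [h2] at h1
  exact Nat.eq_of_mul_eq_mul_left i.pos (Nat.add_right_cancel h1)

/-- The set of the vertices that correspond to an address. -/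
def multiSet (s : ℕ) (a : Fin ((n / s) ^ s)) : Finset (Fin n) :=
  Finset.univ.image (multiVertex s (finFunctionFinEquiv.symm a))

theorem card_multiSet (s : ℕ) (a : Fin ((n / s) ^ s)) : (multiSet s a).card = s := by
  rw [multiSet, Finset.card_image_of_injective _ fun i j h => (multiVertex_inj h).1,
    Finset.card_univ, Fintype.card_fin]

theorem multiSet_injective (s : ℕ) : Function.Injective (multiSet (n := n) s) := by
  intro a a' h
  refine finFunctionFinEquiv.symm.injective (funext fun j => ?_)
  have hj : multiVertex s (finFunctionFinEquiv.symm a) j ∈ multiSet s a' := by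
    rw [← h]
    exact Finset.mem_image_of_mem _ (Finset.mem_univ j)
  obtain ⟨i, -, hi⟩ := Finset.mem_image.1 hj
  obtain ⟨rfl, h2⟩ := multiVertex_inj hi
  exact h2.symm

/-- The hyperedges used by the reduction: those that encode the edges of the graph, and those
that encode the first `N` random bits. -/
def usedEdge {N : ℕ} (hN : N ≤ (n / (t + 2)) ^ (t + 2)) :
    {e : Finset (Fin n) // e.card = 2} ⊕ Fin N →
      {e : Finset (Fin (t + n)) // e.card = t + 2}
  | Sum.inl e => ⟨extend t e.1, by rw [card_extend, e.2]⟩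
  | Sum.inr a => ⟨shift t (multiSet (t + 2) (Fin.castLE hN a)), by
      rw [shift, Finset.card_map, card_multiSet]⟩

/-- The two kinds of hyperedges are distinguished by the first vertex, which exists as `0 < t`. -/
theorem usedEdge_injective (ht : 0 < t) {N : ℕ} (hN : N ≤ (n / (t + 2)) ^ (t + 2)) :
    Function.Injective (usedEdge t hN) := by
  have hne : ∀ K L : Finset (Fin n), extend t K ≠ shift t L := by
    intro K L h
    have := castAdd_mem_extend t K ⟨0, ht⟩
    rw [h, shift, Finset.mem_map] at this
    obtain ⟨v, -, hv⟩ := this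
    have := congrArg Fin.val hv
    simp at this
    omega
  rintro (e | a) (e' | a') h <;> have h := congrArg Subtype.val h <;> simp only [usedEdge] at h
  · rw [Subtype.ext (extend_injective t h)]
  · exact absurd h (hne _ _)
  · exact absurd h.symm (hne _ _)
  · rw [Fin.castLE_injective hN (multiSet_injective _ (Finset.map_injective _ h))]

end Edges

/-! ### The virtual input on encodings of hypergraphs -/

section Encoding

variable {s N : ℕ} (k : ℕ) (H : UniformHypergraph s N)

theorem encodeHypergraph_eq : encodeHypergraph s N k H =
    encodeNat N ++ (encodeNat k ++ (adjacencyBits H ++ encodeNat s)) := by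
  simp [encodeHypergraph]

theorem inputSize_encodeHypergraph : inputSize (encodeHypergraph s N k H) = N := by
  refine ones_eq (fun j hj => ?_) ?_
  · rw [encodeHypergraph_eq, getElem?_encodeNat_append, if_pos (by omega)]
  · rw [encodeHypergraph_eq, getElem?_encodeNat_append, if_neg (by omega), if_pos (by omega)]
    simp

theorem inputClique_encodeHypergraph : inputClique (encodeHypergraph s N k H) = k := by
  rw [inputClique, inputSize_encodeHypergraph]
  refine ones_eq (fun j hj => ?_) ?_
  · rw [encodeHypergraph_eq, getElem?_encodeNat_append, if_neg (by omega), if_neg (by omega),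
      getElem?_encodeNat_append, if_pos (by omega)]
  · rw [encodeHypergraph_eq, getElem?_encodeNat_append, if_neg (by omega), if_neg (by omega),
      getElem?_encodeNat_append, if_neg (by omega), if_pos (by omega)]
    simp

theorem ofDigits_ofFn (b : ℕ) {m : ℕ} (f : Fin m → ℕ) :
    Nat.ofDigits b (List.ofFn f) = ∑ i, f i * b ^ i.val := by
  induction m with
  | zero => simp
  | succ m ih =>
      rw [List.ofFn_succ, Nat.ofDigits_cons, ih, Fin.sum_univ_succ, Finset.mul_sum]
      simp only [Fin.val_zero, pow_zero, mul_one, Fin.val_succ, pow_succ]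
      congr 1
      exact Finset.sum_congr rfl fun i _ => by ring

/-- On the encoding of a hypergraph, the address of a tensor entry is the number whose digits in
base `N` are the vertices. -/
theorem tensorBit_encodeHypergraph (f : Fin s → Fin N) :
    tensorBit (encodeHypergraph s N k H) (List.ofFn fun i => (f i).val) =
      if h : (Finset.univ.image f).card = s then H ⟨_, h⟩ else false := by
  have hidx : Nat.ofDigits N (List.ofFn fun i => (f i).val) = (finFunctionFinEquiv f).val := by
    rw [ofDigits_ofFn, finFunctionFinEquiv_apply]
  have hlen : (adjacencyBits H).length = N ^ s := by simp [adjacencyBits]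
  have hlt := (finFunctionFinEquiv f).isLt
  rw [tensorBit, inputSize_encodeHypergraph, inputClique_encodeHypergraph, hidx,
    encodeHypergraph_eq, getElem?_encodeNat_append, if_neg (by omega), if_neg (by omega),
    getElem?_encodeNat_append, if_neg (by omega), if_neg (by omega),
    show N + k + 2 + (finFunctionFinEquiv f).val - (N + 1) - (k + 1) =
      (finFunctionFinEquiv f).val by omega,
    List.getElem?_append_left (by omega), List.getElem?_eq_getElem (by omega)]
  have hget : (adjacencyBits H)[(finFunctionFinEquiv f).val]'(by omega) =
      if h : (Finset.univ.image f).card = s then H ⟨_, h⟩ else false := by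
    simp only [adjacencyBits, List.getElem_ofFn, Fin.eta, Equiv.symm_apply_apply]
  rw [hget]
  simp only [Option.some.injEq, Bool.decide_eq_true]

end Encoding

section Virtual

variable {n t : ℕ} (k : ℕ) (H : UniformHypergraph (t + 2) (t + n))

/-- The graph that is encoded by a hypergraph: two of the last `n` vertices are adjacent if they
form a hyperedge together with the first `t` vertices. -/
def linkGraph {n t : ℕ} (H : UniformHypergraph (t + 2) (t + n)) : UniformHypergraph 2 n :=
  fun e => H ⟨extend t e.1, by rw [card_extend, e.2]⟩

/-- The tuple of the first `t` vertices and two further ones. -/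
def pairFun {n : ℕ} (t : ℕ) (u v : Fin n) (i : Fin (t + 2)) : Fin (t + n) :=
  if h : i.val < t then Fin.castAdd n ⟨i.val, h⟩
  else if i.val = t then Fin.natAdd t u else Fin.natAdd t v

theorem pairTuple_eq (u v : Fin n) :
    pairTuple t u v = List.ofFn fun i => (pairFun t u v i).val := by
  refine List.ext_getElem (by simp [pairTuple]) fun i h1 h2 => ?_
  simp only [List.length_ofFn] at h2
  simp only [List.getElem_ofFn, pairFun, pairTuple]
  rw [List.getElem_append]
  split_ifs with h3 h4 h4 h5 h5
  all_goals simp only [List.length_range] at h3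
  all_goals try omega
  · simp
  · simp [h5]
  · have : i - t = 1 := by omega
    simp [this]

theorem image_pairFun (u v : Fin n) :
    Finset.univ.image (pairFun t u v) = extend t {u, v} := by
  ext w
  rw [Finset.mem_image]
  constructor
  · rintro ⟨i, -, rfl⟩
    simp only [pairFun]
    split_ifs
    · exact castAdd_mem_extend _ _ _
    · rw [natAdd_mem_extend]
      simp
    · rw [natAdd_mem_extend]
      simp
  · refine Fin.addCases (fun i _ => ?_) (fun i hi => ?_) w
    · exact ⟨Fin.castAdd 2 i, Finset.mem_univ _, by simp [pairFun]⟩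
    · rw [natAdd_mem_extend, Finset.mem_insert, Finset.mem_singleton] at hi
      rcases hi with rfl | rfl
      · exact ⟨⟨t, by omega⟩, Finset.mem_univ _, by simp [pairFun]⟩
      · exact ⟨⟨t + 1, by omega⟩, Finset.mem_univ _, by simp [pairFun]⟩

theorem virtualInput_encodeHypergraph :
    virtualInput t (encodeHypergraph (t + 2) (t + n) (t + k) H) =
      encodeGraph n k (linkGraph H) := by
  rw [virtualInput, inputSize_encodeHypergraph, inputClique_encodeHypergraph,
    Nat.add_sub_cancel_left, Nat.add_sub_cancel_left, encodeGraph, adjacencyBits]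
  congr 2
  funext j
  set f := finFunctionFinEquiv.symm j with hf
  have h0 : j.val % n = (f 0).val := by
    rw [hf, finFunctionFinEquiv_symm_apply_val]
    simp
  have h1 : j.val / n % n = (f 1).val := by
    rw [hf, finFunctionFinEquiv_symm_apply_val]
    simp
  have himage : Finset.univ.image f = {f 0, f 1} := by
    ext w
    simp [Fin.exists_fin_two, eq_comm]
  rw [h0, h1]
  by_cases h : f 0 = f 1
  · rw [if_pos (by rw [h]), dif_neg]
    rw [himage, h]
    simp
  · have hc : (Finset.univ.image f).card = 2 := by
      rw [himage, Finset.card_pair h]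
    rw [if_neg (fun h' => h (Fin.ext h')), dif_pos hc, pairTuple_eq, tensorBit_encodeHypergraph,
      dif_pos (by rw [image_pairFun, card_extend, Finset.card_pair h])]
    simp only [linkGraph, image_pairFun, himage]

theorem virtualMulti_encodeHypergraph (a : Fin ((n / (t + 2)) ^ (t + 2))) :
    virtualMulti t (encodeHypergraph (t + 2) (t + n) (t + k) H) a.val =
      H ⟨shift t (multiSet (t + 2) a), by rw [shift, Finset.card_map, card_multiSet]⟩ := by
  set f : Fin (t + 2) → Fin (t + n) := fun j =>
    Fin.natAdd t (multiVertex (t + 2) (finFunctionFinEquiv.symm a) j) with hf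
  have himage : Finset.univ.image f = shift t (multiSet (t + 2) a) := by
    rw [shift, multiSet, Finset.map_eq_image, Finset.image_image]
    rfl
  have htuple : multiTuple t (n / (t + 2)) a.val = List.ofFn fun j => (f j).val := by
    refine List.ext_getElem (by simp [multiTuple]) fun j h1 h2 => ?_
    rw [List.getElem_ofFn]
    simp [multiTuple, hf, multiVertex, finFunctionFinEquiv_symm_apply_val]
  rw [virtualMulti, inputSize_encodeHypergraph, Nat.add_sub_cancel_left, htuple,
    tensorBit_encodeHypergraph,
    dif_pos (by rw [himage, shift, Finset.card_map, card_multiSet])]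
  simp only [himage]

end Virtual

/-! ### Averages -/

/-- The expectation of a function under a discrete law. -/
noncomputable def avg {α : Type*} (P : PMF α) (g : α → ℝ≥0∞) : ℝ≥0∞ := ∑' a, P a * g a

section Average

variable {α β : Type*}

theorem avg_bind (P : PMF α) (f : α → PMF β) (g : β → ℝ≥0∞) :
    avg (P.bind f) g = avg P fun a => avg (f a) g := by
  simp only [avg, PMF.bind_apply, ← ENNReal.tsum_mul_right, ← ENNReal.tsum_mul_left]
  rw [ENNReal.tsum_comm]
  simp only [mul_assoc]

theorem avg_pure (a : α) (g : α → ℝ≥0∞) : avg (PMF.pure a) g = g a := by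
  rw [avg, tsum_eq_single a fun b hb => by simp [PMF.pure_apply, hb]]
  simp

theorem avg_map (P : PMF α) (f : α → β) (g : β → ℝ≥0∞) :
    avg (P.map f) g = avg P fun a => g (f a) := by
  rw [PMF.map, avg_bind]
  simp only [Function.comp, avg_pure]

theorem avg_mono (P : PMF α) {g h : α → ℝ≥0∞} (hgh : ∀ a ∈ P.support, g a ≤ h a) :
    avg P g ≤ avg P h := by
  refine ENNReal.tsum_le_tsum fun a => ?_
  by_cases ha : P a = 0
  · simp [ha]
  · exact mul_le_mul_right (hgh a ha) _

theorem avg_add (P : PMF α) (g h : α → ℝ≥0∞) :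
    avg P (fun a => g a + h a) = avg P g + avg P h := by
  simp only [avg, mul_add, ENNReal.tsum_add]

theorem avg_one (P : PMF α) : avg P (fun _ => 1) = 1 := by
  simp [avg, P.tsum_coe]

theorem avg_le_one (P : PMF α) {g : α → ℝ≥0∞} (hg : ∀ a, g a ≤ 1) : avg P g ≤ 1 :=
  (avg_mono P fun a _ => hg a).trans (avg_one P).le

theorem avg_sum {ι : Type*} (P : PMF α) (s : Finset ι) (g : ι → α → ℝ≥0∞) :
    avg P (fun a => ∑ i ∈ s, g i a) = ∑ i ∈ s, avg P (g i) := by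
  simp only [avg, Finset.mul_sum]
  exact Summable.tsum_finsetSum fun i _ => ENNReal.summable

theorem avg_uniform [Fintype α] [Nonempty α] (g : α → ℝ≥0∞) :
    avg (PMF.uniformOfFintype α) g = (Fintype.card α : ℝ≥0∞)⁻¹ * ∑ a, g a := by
  simp only [avg, PMF.uniformOfFintype_apply, tsum_fintype, Finset.mul_sum]

theorem eq_uniformOfFintype [Fintype α] [Nonempty α] (P : PMF α) (h : ∀ a b, P a = P b) :
    P = PMF.uniformOfFintype α := by
  ext a
  have h1 := P.tsum_coe
  simp only [h _ a, tsum_fintype, Finset.sum_const, Finset.card_univ, nsmul_eq_mul] at h1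
  rw [PMF.uniformOfFintype_apply]
  rw [mul_comm] at h1
  exact ENNReal.eq_inv_of_mul_eq_one_left h1

/-- The restriction of a family of independent fair bits along an injective map is a family of
independent fair bits. -/
theorem map_uniform_comp {I E : Type} [Fintype I] [Fintype E] [DecidableEq I] [DecidableEq E]
    (ι : I → E) (hι : Function.Injective ι) :
    (PMF.uniformOfFintype (E → Bool)).map (fun H => H ∘ ι) =
      PMF.uniformOfFintype (I → Bool) := by
  refine eq_uniformOfFintype _ fun f f' => ?_
  -- adding a fixed vector modulo 2 permutes the families and turns `f` into `f'`
  set d : E → Bool := Function.extend ι (fun i => xor (f i) (f' i)) fun _ => false with hd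
  have hinv : Function.Involutive fun (H : E → Bool) e => xor (H e) (d e) := by
    intro H
    funext e
    simp
  rw [PMF.map_apply, PMF.map_apply, ← (hinv.toPerm _).tsum_eq]
  refine tsum_congr fun H => ?_
  have hiff : f = (hinv.toPerm _ H) ∘ ι ↔ f' = H ∘ ι := by
    simp only [funext_iff, Function.Involutive.coe_toPerm, Function.comp, hd,
      hι.extend_apply]
    refine forall_congr' fun i => ?_
    cases f i <;> cases f' i <;> cases H (ι i) <;> simp
  simp only [hiff, PMF.uniformOfFintype_apply]

theorem avg_uniform_sum {I J : Type} [Fintype I] [Fintype J] [DecidableEq I] [DecidableEq J]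
    (g : (I → Bool) → (J → Bool) → ℝ≥0∞) :
    avg (PMF.uniformOfFintype (I ⊕ J → Bool)) (fun f => g (f ∘ Sum.inl) (f ∘ Sum.inr)) =
      avg (PMF.uniformOfFintype (I → Bool)) fun G =>
        avg (PMF.uniformOfFintype (J → Bool)) (g G) := by
  simp only [avg_uniform, ← Finset.mul_sum]
  rw [← mul_assoc]
  congr 1
  · rw [Fintype.card_congr (Equiv.sumArrowEquivProdArrow I J Bool), Fintype.card_prod,
      Nat.cast_mul, ENNReal.mul_inv (by simp) (by simp)]
  · rw [← Fintype.sum_prod_type']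
    exact Fintype.sum_equiv (Equiv.sumArrowEquivProdArrow I J Bool) _ _ fun f => rfl

end Average

/-! ### Probabilities of outputs -/

instance : IsProbabilityMeasure coinMeasure := by
  unfold coinMeasure
  infer_instance

/-- A finite family of bits, continued by zeros. -/
def padBits {N : ℕ} (β : Fin N → Bool) (a : ℕ) : Bool := if h : a < N then β ⟨a, h⟩ else false

theorem coinMeasure_prefix (N : ℕ) (β : Fin N → Bool) :
    coinMeasure {r | (fun i : Fin N => r i) = β} =
      (Fintype.card (Fin N → Bool) : ℝ≥0∞)⁻¹ := by
  have h1 : {r : ℕ → Bool | (fun i : Fin N => r i) = β} =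
      Set.pi (Finset.range N) fun i => {padBits β i} := by
    ext r
    simp only [Set.mem_ofPred_eq, funext_iff, Set.mem_pi, Finset.coe_range, Set.mem_Iio,
      Set.mem_singleton_iff]
    constructor
    · intro h i hi
      rw [padBits, dif_pos hi]
      exact h ⟨i, hi⟩
    · intro h i
      have := h i i.isLt
      rwa [padBits, dif_pos i.isLt] at this
  rw [h1, coinMeasure, Measure.infinitePi_pi _ fun i _ => MeasurableSet.of_discrete]
  have h2 : ∀ b : Bool, (PMF.uniformOfFintype Bool).toMeasure {b} = 2⁻¹ := by
    intro b
    rw [PMF.toMeasure_apply_singleton _ _ (MeasurableSet.singleton b)]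
    simp
  simp only [h2, Finset.prod_const, Finset.card_range]
  simp [ENNReal.inv_pow]

/-- The probability of the output `b` on the input `x`. -/
noncomputable def runProb (M : Machine) (x : List Bool) (b : Bool) : ℝ≥0∞ :=
  (coinMeasure.prod coinMeasure) {r | M.Outputs x r.1 r.2 b}

theorem outputProb_eq (M : Machine) (P : PMF (List Bool)) (b : Bool) :
    outputProb M P b = avg P fun x => runProb M x b := rfl

theorem runProb_le_one (M : Machine) (x : List Bool) (b : Bool) : runProb M x b ≤ 1 :=
  prob_le_one

/-- The probability of the output `b` on the input `x`, given the multiple access random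
string. -/
noncomputable def runProbGiven (M : Machine) (x : List Bool) (ma : ℕ → Bool) (b : Bool) : ℝ≥0∞ :=
  coinMeasure {ro | M.Outputs x ro ma b}

theorem runProb_of_forall (M S : Machine) (x x' : List Bool) (ma' : ℕ → Bool) (b : Bool)
    (h : ∀ ro ma, M.Outputs x ro ma b ↔ S.Outputs x' ro ma' b) :
    runProb M x b = runProbGiven S x' ma' b := by
  have : {r : (ℕ → Bool) × (ℕ → Bool) | M.Outputs x r.1 r.2 b} =
      {ro | S.Outputs x' ro ma' b} ×ˢ Set.univ := by
    ext r
    simp [h]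
  rw [runProb, this, Measure.prod_prod, measure_univ, mul_one, runProbGiven]

/-- A machine whose registers stay below `N` only reads the first `N` multiple access random
bits. -/
theorem Machine.run_congr (M : Machine) (x : List Bool) (ro ma ma' : ℕ → Bool) (N : ℕ)
    (hreg : ∀ t r, (M.run x ro ma t).reg r < N) (hma : ∀ a < N, ma a = ma' a) (t : ℕ) :
    M.run x ro ma' t = M.run x ro ma t := by
  induction t with
  | zero => rfl
  | succ t ih =>
      have h1 : ∀ m, M.run x ro m (t + 1) = M.step x ro m (M.run x ro m t) := fun m =>
        Function.iterate_succ_apply' _ _ _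
      rw [h1, h1, ih, M.step_eq _ _ _ rfl, M.step_eq _ _ _ rfl]
      have h2 := hreg t
      generalize M.run x ro ma t = c at h2
      cases M.code c.state <;> simp only [Instr.act, hma _ (h2 _)]

theorem Machine.outputs_congr (M : Machine) (x : List Bool) (ro ma ma' : ℕ → Bool) (N : ℕ)
    (hreg : ∀ t r, (M.run x ro ma t).reg r < N) (hma : ∀ a < N, ma a = ma' a) (b : Bool) :
    M.Outputs x ro ma b ↔ M.Outputs x ro ma' b := by
  simp only [Machine.Outputs, Machine.OutputsWithin, M.run_congr x ro ma ma' N hreg hma]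

theorem Machine.SpaceAtMost.reg_lt {M : Machine} {c : Config M.State M.Reg} {B : ℕ}
    (h : Machine.SpaceAtMost c B) (r : M.Reg) : c.reg r < 2 ^ B := by
  obtain ⟨u, -, hsum⟩ := h
  have := Finset.single_le_sum (f := fun r => Nat.size (c.reg r)) (fun _ _ => Nat.zero_le _)
    (Finset.mem_univ r)
  exact Nat.size_le.1 (by omega)

/-- Only the first `N` multiple access random bits matter if the registers contain numbers
below `N`. -/
theorem runProb_eq_avg (M : Machine) (x : List Bool) (b : Bool) (N : ℕ)
    (hreg : ∀ ro ma t r, (M.run x ro ma t).reg r < N) :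
    runProb M x b =
      avg (PMF.uniformOfFintype (Fin N → Bool)) fun β => runProbGiven M x (padBits β) b := by
  set T : Set ((ℕ → Bool) × (ℕ → Bool)) := {r | M.Outputs x r.1 r.2 b} with hT
  set p : (ℕ → Bool) × (ℕ → Bool) → Fin N → Bool := fun r i => r.2 i with hp
  have hpm : Measurable p := by
    refine measurable_pi_lambda _ fun i => ?_
    exact (measurable_pi_apply i.val).comp measurable_snd
  have h1 := sum_measure_preimage_singleton (μ := (coinMeasure.prod coinMeasure).restrict T)
    (f := p) Finset.univ fun β _ => hpm (MeasurableSet.singleton β)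
  rw [Finset.coe_univ, Set.preimage_univ, Measure.restrict_apply_univ] at h1
  rw [runProb, ← hT, ← h1, avg_uniform, Finset.mul_sum]
  refine Finset.sum_congr rfl fun β _ => ?_
  rw [Measure.restrict_apply (hpm (MeasurableSet.singleton β))]
  have h2 : p ⁻¹' {β} ∩ T =
      {ro | M.Outputs x ro (padBits β) b} ×ˢ {r | (fun i : Fin N => r i) = β} := by
    ext r
    simp only [Set.mem_inter_iff, Set.mem_preimage, Set.mem_singleton_iff, Set.mem_prod,
      Set.mem_ofPred_eq, hT, hp]
    rw [and_comm]
    refine and_congr_left fun h => ?_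
    refine M.outputs_congr x _ _ _ N (hreg _ _) (fun a ha => ?_) b
    rw [padBits, dif_pos ha, ← h]
  rw [h2, Measure.prod_prod, coinMeasure_prefix, mul_comm, runProbGiven]

/-! ### The clique leakage distribution -/

/-- A law that is proportional to the restriction of `p` to `S` is the conditional law. -/
theorem filter_eq_of_proportional {α : Type*} (p q : PMF α) (S : Set α)
    (hS : ∃ a ∈ S, a ∈ p.support) (b : ℝ≥0∞) (h : ∀ a, q a = b * S.indicator p a) :
    p.filter S hS = q := by
  ext a
  have h1 : b * ∑' a, S.indicator p a = 1 := by
    rw [← ENNReal.tsum_mul_left, ← q.tsum_coe]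
    exact tsum_congr fun a => (h a).symm
  rw [PMF.filter_apply, h, ← ENNReal.eq_inv_of_mul_eq_one_left h1, mul_comm]

/-- A pair whose first component is `φ a` for a random `a`, and whose second component is drawn
depending on the first one, takes the value `(φ a, H)` with the product of the two probabilities. -/
theorem bind_map_prod_apply {α β γ : Type*} (p : PMF α) (u : PMF γ) (φ : α → β)
    (hφ : Function.Injective φ) (f : β → γ → γ) (a : α) (H : γ) :
    (p.bind fun a => u.map fun G => (φ a, f (φ a) G)) (φ a, H) =
      p a * (u.map (f (φ a))) H := by
  classical
  rw [PMF.bind_apply, tsum_eq_single a]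
  · congr 1
    simp only [PMF.map_apply, Prod.mk.injEq, true_and]
  · intro a' ha'
    have : (u.map fun G => (φ a', f (φ a') G)) (φ a, H) = 0 := by
      rw [PMF.map_apply, ENNReal.tsum_eq_zero]
      intro G
      rw [if_neg]
      intro h
      exact ha' (hφ (Prod.ext_iff.1 h).1).symm
    rw [this, mul_zero]

theorem bind_map_prod_apply_eq_zero {α β γ : Type*} (p : PMF α) (u : PMF γ) (φ : α → β)
    (f : β → γ → γ) (K : β) (hK : ∀ a, φ a ≠ K) (H : γ) :
    (p.bind fun a => u.map fun G => (φ a, f (φ a) G)) (K, H) = 0 := by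
  classical
  rw [PMF.bind_apply, ENNReal.tsum_eq_zero]
  intro a
  rw [PMF.map_apply, mul_eq_zero]
  right
  rw [ENNReal.tsum_eq_zero]
  intro G
  rw [if_neg]
  intro h
  exact hK a (Prod.ext_iff.1 h).1.symm

/-- In the clique leakage distribution on `t + n` vertices, the clique set consists of the first
`t` vertices and of a uniformly random set of `k` other vertices. -/
theorem cliqueLeakage_eq (t n k : ℕ) (hsk : t + 2 - 2 ≤ t + k) (hkn' : t + k ≤ t + n)
    (hkn : k ≤ n) :
    cliqueLeakage (t + 2) (t + n) (t + k) hsk hkn' =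
      (PMF.uniformOfFinset _ (powersetCard_univ_nonempty hkn)).bind fun K =>
        (erdosRenyi (t + 2) (t + n)).map (plant (extend t K)) := by
  classical
  set q := (PMF.uniformOfFinset _ (powersetCard_univ_nonempty hkn)).bind fun K =>
    (erdosRenyi (t + 2) (t + n)).map fun G => (extend t K, plant (extend t K) G) with hq
  have key : (plantedJoint (t + 2) (t + n) (t + k) hkn').filter (leakEvent (t + 2) (t + n))
      (leakEvent_possible hsk hkn') = q := by
    refine filter_eq_of_proportional _ _ _ _
      (((t + n).choose (t + k) : ℝ≥0∞) * (n.choose k : ℝ≥0∞)⁻¹) ?_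
    rintro ⟨K, H⟩
    by_cases hK : ∃ K₀ : Finset (Fin n), extend t K₀ = K
    · obtain ⟨K₀, rfl⟩ := hK
      have hmem : (extend t K₀, H) ∈ leakEvent (t + 2) (t + n) := by
        intro v hv
        have : v = Fin.castAdd n ⟨v.val, hv⟩ := rfl
        rw [this]
        exact castAdd_mem_extend t K₀ _
      have hjoint : plantedJoint (t + 2) (t + n) (t + k) hkn' (extend t K₀, H) = _ :=
        bind_map_prod_apply _ _ id Function.injective_id plant (extend t K₀) H
      rw [Set.indicator_of_mem hmem, hq, bind_map_prod_apply _ _ (extend t) (extend_injective t)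
        plant, hjoint, PMF.uniformOfFinset_apply, PMF.uniformOfFinset_apply, ← mul_assoc, id]
      congr 1
      simp only [Finset.mem_powersetCard, Finset.subset_univ, true_and, card_extend,
        Nat.add_left_cancel_iff, Finset.card_powersetCard, Finset.card_univ, Fintype.card_fin]
      split_ifs
      · rw [mul_comm (_ : ℝ≥0∞) (_⁻¹), ← mul_assoc, ENNReal.inv_mul_cancel, one_mul]
        · exact_mod_cast (Nat.choose_pos hkn').ne'
        · exact ENNReal.natCast_ne_top _
      · simp
    · have hnot : (K, H) ∉ leakEvent (t + 2) (t + n) := by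
        intro hleak
        refine hK ⟨Finset.univ.filter fun v => Fin.natAdd t v ∈ K, ?_⟩
        ext v
        refine Fin.addCases (fun i => ?_) (fun i => ?_) v
        · exact iff_of_true (castAdd_mem_extend t _ i) (hleak _ i.isLt)
        · rw [natAdd_mem_extend]
          simp
      rw [Set.indicator_of_notMem hnot, mul_zero, hq]
      exact bind_map_prod_apply_eq_zero _ _ (extend t) plant K (fun K₀ h => hK ⟨K₀, h⟩) H
  rw [cliqueLeakage, key, hq, PMF.map_bind]
  simp only [PMF.map_comp]
  rfl

/-! ### The probability that random bits are spoiled by the clique -/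

theorem descFactorial_mul_pow_le {k n : ℕ} (hkn : k ≤ n) (s : ℕ) :
    k.descFactorial s * n ^ s ≤ k ^ s * n.descFactorial s := by
  induction s with
  | zero => simp
  | succ s ih =>
      have h : (k - s) * n ≤ k * (n - s) := by
        rw [Nat.sub_mul, Nat.mul_sub]
        exact Nat.sub_le_sub_left (by nlinarith) _
      rw [Nat.descFactorial_succ, Nat.descFactorial_succ, pow_succ, pow_succ]
      calc (k - s) * k.descFactorial s * (n ^ s * n)
          = (k.descFactorial s * n ^ s) * ((k - s) * n) := by ring
        _ ≤ (k ^ s * n.descFactorial s) * (k * (n - s)) := Nat.mul_le_mul ih h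
        _ = _ := by ring

theorem choose_sub_mul_pow_le {s k n : ℕ} (hsk : s ≤ k) (hkn : k ≤ n) :
    (n - s).choose (k - s) * n ^ s ≤ k ^ s * n.choose k := by
  have h1 : k.choose s * n ^ s ≤ k ^ s * n.choose s := by
    have := descFactorial_mul_pow_le hkn s
    rw [Nat.descFactorial_eq_factorial_mul_choose, Nat.descFactorial_eq_factorial_mul_choose,
      mul_assoc, mul_left_comm (k ^ s)] at this
    exact Nat.le_of_mul_le_mul_left this (Nat.factorial_pos s)
  have h2 := Nat.choose_mul (n := n) hsk
  have h3 : 0 < n.choose s := Nat.choose_pos (hsk.trans hkn)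
  refine Nat.le_of_mul_le_mul_left ?_ h3
  calc n.choose s * ((n - s).choose (k - s) * n ^ s)
      = n.choose k * (k.choose s * n ^ s) := by rw [← mul_assoc, ← h2, mul_assoc]
    _ ≤ n.choose k * (k ^ s * n.choose s) := Nat.mul_le_mul_left _ h1
    _ = _ := by ring

/-- A uniformly random set of `k` vertices contains a given set of `s` vertices with probability
at most `(k / n) ^ s`. -/
theorem avg_subset_le {n k : ℕ} (hn : 0 < n) (hkn : k ≤ n) (e : Finset (Fin n)) :
    avg (PMF.uniformOfFinset _ (powersetCard_univ_nonempty hkn))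
      (fun K => if e ⊆ K then 1 else 0) ≤ (k : ℝ≥0∞) ^ e.card / (n : ℝ≥0∞) ^ e.card := by
  set F := (Finset.powersetCard k (Finset.univ : Finset (Fin n))).filter fun K => e ⊆ K with hF
  have h1 : avg (PMF.uniformOfFinset _ (powersetCard_univ_nonempty hkn))
      (fun K => if e ⊆ K then 1 else 0) = (n.choose k : ℝ≥0∞)⁻¹ * F.card := by
    rw [avg, tsum_fintype, hF, Finset.card_filter, Nat.cast_sum, Finset.mul_sum,
      ← Finset.sum_subset (Finset.subset_univ (Finset.powersetCard k Finset.univ))]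
    · refine Finset.sum_congr rfl fun K hK => ?_
      rw [PMF.uniformOfFinset_apply, if_pos hK, Finset.card_powersetCard, Finset.card_univ,
        Fintype.card_fin]
      simp
    · intro K _ hK
      rw [PMF.uniformOfFinset_apply, if_neg hK, zero_mul]
  have h2 : F.card * n ^ e.card ≤ k ^ e.card * n.choose k := by
    by_cases hek : e.card ≤ k
    · have h3 : F.card ≤ (n - e.card).choose (k - e.card) := by
        have : (Finset.powersetCard (k - e.card) (Finset.univ \ e)).card =
            (n - e.card).choose (k - e.card) := by
          rw [Finset.card_powersetCard, Finset.card_sdiff_of_subset (Finset.subset_univ e),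
            Finset.card_univ, Fintype.card_fin]
        rw [← this]
        refine Finset.card_le_card_of_injOn (fun K => K \ e) (fun K hK => ?_) ?_
        · obtain ⟨hK1, hK2⟩ := Finset.mem_filter.1 hK
          rw [Finset.mem_coe, Finset.mem_powersetCard]
          refine ⟨Finset.sdiff_subset_sdiff (Finset.subset_univ K) le_rfl, ?_⟩
          rw [Finset.card_sdiff_of_subset hK2, (Finset.mem_powersetCard.1 hK1).2]
        · intro K hK L hL h
          have h4 := (Finset.mem_filter.1 hK).2
          have h5 := (Finset.mem_filter.1 hL).2
          rw [← Finset.sdiff_union_of_subset h4, ← Finset.sdiff_union_of_subset h5]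
          exact congrArg (· ∪ e) h
      exact (Nat.mul_le_mul_right _ h3).trans (choose_sub_mul_pow_le hek hkn)
    · have : F = ∅ := by
        refine Finset.filter_eq_empty_iff.2 fun K hK h => hek ?_
        rw [← (Finset.mem_powersetCard.1 hK).2]
        exact Finset.card_le_card h
      simp [this]
  rw [h1, ENNReal.le_div_iff_mul_le (Or.inl (by positivity)) (Or.inl (by finiteness)), mul_assoc]
  have h6 : (F.card : ℝ≥0∞) * (n : ℝ≥0∞) ^ e.card ≤ (k : ℝ≥0∞) ^ e.card * (n.choose k : ℝ≥0∞) := by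
    exact_mod_cast h2
  have h7 : (n.choose k : ℝ≥0∞) ≠ 0 := by exact_mod_cast (Nat.choose_pos hkn).ne'
  calc (n.choose k : ℝ≥0∞)⁻¹ * (F.card * (n : ℝ≥0∞) ^ e.card)
      ≤ (n.choose k : ℝ≥0∞)⁻¹ * ((k : ℝ≥0∞) ^ e.card * (n.choose k : ℝ≥0∞)) :=
        mul_le_mul_right h6 _
    _ = (k : ℝ≥0∞) ^ e.card := by
        rw [mul_left_comm, ENNReal.inv_mul_cancel h7 (ENNReal.natCast_ne_top _), mul_one]

/-! ### The reduction -/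

section Reduction

/-- The random bits that are encoded by a hypergraph. -/
def extractedBits {t n N : ℕ} (hN : N ≤ (n / (t + 2)) ^ (t + 2))
    (H : UniformHypergraph (t + 2) (t + n)) : Fin N → Bool :=
  fun a => H (usedEdge t hN (Sum.inr a))

variable {t n N : ℕ}

/-- The graph and the random bits that are encoded by a random hypergraph are independent and
uniform. -/
theorem avg_erdosRenyi_eq (hN : N ≤ (n / (t + 2)) ^ (t + 2))
    (ht : 0 < t) (g : UniformHypergraph 2 n → (Fin N → Bool) → ℝ≥0∞) :
    avg (erdosRenyi (t + 2) (t + n)) (fun H => g (linkGraph H) (extractedBits hN H)) =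
      avg (erdosRenyi 2 n) fun G => avg (PMF.uniformOfFintype (Fin N → Bool)) (g G) := by
  rw [erdosRenyi, erdosRenyi, ← avg_uniform_sum, ← map_uniform_comp _ (usedEdge_injective t ht hN),
    avg_map]
  rfl

theorem linkGraph_plant (K : Finset (Fin n)) (H : UniformHypergraph (t + 2) (t + n)) :
    linkGraph (plant (extend t K) H) = plant K (linkGraph H) := by
  funext e
  simp only [linkGraph, plant, extend_subset_extend]

theorem extractedBits_plant (hN : N ≤ (n / (t + 2)) ^ (t + 2))
    (K : Finset (Fin n)) (H : UniformHypergraph (t + 2) (t + n))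
    (hK : ∀ a : Fin N, ¬ multiSet (t + 2) (Fin.castLE hN a) ⊆ K) :
    extractedBits hN (plant (extend t K) H) = extractedBits hN H := by
  funext a
  simp only [extractedBits, usedEdge, plant, shift_subset_extend, hK a, decide_false,
    Bool.false_or]

theorem runProb_encodeHypergraph (hN : N ≤ (n / (t + 2)) ^ (t + 2))
    (S A : Machine) (k : ℕ)
    (hA : ∀ x ro ma b,
      A.Outputs x ro ma b ↔ S.Outputs (virtualInput t x) ro (virtualMulti t x) b)
    (hreg : ∀ (G : UniformHypergraph 2 n) ro ma u r,
      (S.run (encodeGraph n k G) ro ma u).reg r < N)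
    (H : UniformHypergraph (t + 2) (t + n)) (b : Bool) :
    runProb A (encodeHypergraph (t + 2) (t + n) (t + k) H) b =
      runProbGiven S (encodeGraph n k (linkGraph H)) (padBits (extractedBits hN H)) b := by
  refine runProb_of_forall _ _ _ _ _ _ fun ro ma => ?_
  rw [hA, virtualInput_encodeHypergraph]
  refine S.outputs_congr _ _ _ _ N (hreg _ _ _) (fun a ha => ?_) b
  rw [padBits, dif_pos ha]
  exact virtualMulti_encodeHypergraph k H (Fin.castLE hN ⟨a, ha⟩)

/-- The extracted bits replace the multiple access random string. -/
theorem avg_runProb_encodeHypergraph (hN : N ≤ (n / (t + 2)) ^ (t + 2))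
    (S : Machine) (k : ℕ)
    (hreg : ∀ (G : UniformHypergraph 2 n) ro ma u r,
      (S.run (encodeGraph n k G) ro ma u).reg r < N)
    (ht : 0 < t) (φ : UniformHypergraph 2 n → UniformHypergraph 2 n) (b : Bool) :
    avg (erdosRenyi (t + 2) (t + n)) (fun H => runProbGiven S (encodeGraph n k (φ (linkGraph H)))
      (padBits (extractedBits hN H)) b) =
      avg (erdosRenyi 2 n) fun G => runProb S (encodeGraph n k (φ G)) b := by
  rw [avg_erdosRenyi_eq hN ht fun G β => runProbGiven S (encodeGraph n k (φ G)) (padBits β) b]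
  congr 1
  funext G
  exact (runProb_eq_avg S _ b N (hreg _)).symm

/-- The reduction maps the null hypothesis to the null hypothesis. -/
theorem outputProb_null (hN : N ≤ (n / (t + 2)) ^ (t + 2))
    (S A : Machine) (k : ℕ)
    (hA : ∀ x ro ma b,
      A.Outputs x ro ma b ↔ S.Outputs (virtualInput t x) ro (virtualMulti t x) b)
    (hreg : ∀ (G : UniformHypergraph 2 n) ro ma u r,
      (S.run (encodeGraph n k G) ro ma u).reg r < N)
    (ht : 0 < t) (b : Bool) :
    outputProb A ((erdosRenyi (t + 2) (t + n)).map
        (encodeHypergraph (t + 2) (t + n) (t + k))) b =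
      outputProb S ((erdosRenyi 2 n).map (encodeGraph n k)) b := by
  simp only [outputProb_eq, avg_map, runProb_encodeHypergraph hN S A k hA hreg]
  exact avg_runProb_encodeHypergraph hN S k hreg ht id b

/-- The reduction maps the clique leakage distribution to the planted clique distribution, unless
the clique contains one of the sets of vertices that stand for random bits. -/
theorem outputProb_planted_le (hN : N ≤ (n / (t + 2)) ^ (t + 2))
    (S A : Machine) (k : ℕ)
    (hA : ∀ x ro ma b,
      A.Outputs x ro ma b ↔ S.Outputs (virtualInput t x) ro (virtualMulti t x) b)
    (hreg : ∀ (G : UniformHypergraph 2 n) ro ma u r,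
      (S.run (encodeGraph n k G) ro ma u).reg r < N)
    (ht : 0 < t) (hn : 0 < n) (hkn : k ≤ n)
    (hsk : t + 2 - 2 ≤ t + k) (hkn' : t + k ≤ t + n) (b : Bool) :
    outputProb S ((planted 2 n k hkn).map (encodeGraph n k)) b ≤
      outputProb A ((cliqueLeakage (t + 2) (t + n) (t + k) hsk hkn').map
        (encodeHypergraph (t + 2) (t + n) (t + k))) b +
      N * ((k : ℝ≥0∞) ^ (t + 2) / (n : ℝ≥0∞) ^ (t + 2)) := by
  rw [cliqueLeakage_eq t n k hsk hkn' hkn]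
  simp only [outputProb_eq, planted, plantedJoint, avg_map, avg_bind,
    runProb_encodeHypergraph hN S A k hA hreg, linkGraph_plant]
  set U := PMF.uniformOfFinset _ (powersetCard_univ_nonempty hkn)
  have hbad : avg U (fun K => ∑ a : Fin N,
      if multiSet (t + 2) (Fin.castLE hN a) ⊆ K then 1 else 0) ≤
        N * ((k : ℝ≥0∞) ^ (t + 2) / (n : ℝ≥0∞) ^ (t + 2)) := by
    rw [avg_sum]
    calc _ ≤ ∑ _a : Fin N, (k : ℝ≥0∞) ^ (t + 2) / (n : ℝ≥0∞) ^ (t + 2) :=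
          Finset.sum_le_sum fun a _ => by
            simpa only [card_multiSet] using
              avg_subset_le hn hkn (multiSet (t + 2) (Fin.castLE hN a))
      _ = _ := by rw [Finset.sum_const, Finset.card_univ, Fintype.card_fin, nsmul_eq_mul]
  refine le_trans ?_ (add_le_add_right hbad _)
  rw [← avg_add]
  refine avg_mono U fun K _ => ?_
  by_cases hK : ∀ a : Fin N, ¬ multiSet (t + 2) (Fin.castLE hN a) ⊆ K
  · simp only [extractedBits_plant hN K _ hK]
    rw [avg_runProb_encodeHypergraph hN S k hreg ht (plant K) b]
    exact le_self_add
  · push Not at hK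
    obtain ⟨a, ha⟩ := hK
    refine le_trans ?_ le_add_self
    refine (avg_le_one _ fun G => runProb_le_one _ _ _).trans ?_
    refine le_trans ?_ (Finset.single_le_sum (fun _ _ => zero_le) (Finset.mem_univ a))
    rw [if_pos ha]

end Reduction

/-! ### Asymptotic estimates -/

theorem length_encodeGraph (n k : ℕ) (G : UniformHypergraph 2 n) :
    (encodeGraph n k G).length = n + 1 + (k + 1) + n ^ 2 := by
  simp [encodeGraph, length_encodeNat, adjacencyBits, add_assoc]

/-- The number of random bits that `c * log ℓ + c` bits can address, where `ℓ` is the length of the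
input, is polynomial in `n`. -/
theorem addressable_le (c : ℕ) {n k : ℕ} (hn : 0 < n) (hkn : k ≤ n) :
    2 ^ (c * Nat.log 2 (n + 1 + (k + 1) + n ^ 2) + c) ≤ 10 ^ c * n ^ (2 * c) := by
  have h1 : 2 ^ Nat.log 2 (n + 1 + (k + 1) + n ^ 2) ≤ n + 1 + (k + 1) + n ^ 2 :=
    Nat.pow_log_le_self 2 (by omega)
  have h2 : n + 1 + (k + 1) + n ^ 2 ≤ 5 * n ^ 2 := by nlinarith
  calc 2 ^ (c * Nat.log 2 (n + 1 + (k + 1) + n ^ 2) + c)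
      = (2 ^ Nat.log 2 (n + 1 + (k + 1) + n ^ 2) * 2) ^ c := by
        rw [← pow_succ, ← pow_mul]
        ring_nf
    _ ≤ (5 * n ^ 2 * 2) ^ c := Nat.pow_le_pow_left (by omega) c
    _ = 10 ^ c * n ^ (2 * c) := by
        rw [show 5 * n ^ 2 * 2 = 10 * n ^ 2 by ring, mul_pow, ← pow_mul]

/-- For large `n` there are enough addresses of `s` digits in base `n / s` for all random bits. -/
theorem le_div_pow {c s n N : ℕ} (hs : 2 * c < s) (hN : N ≤ 10 ^ c * n ^ (2 * c))
    (hn : 10 ^ c * (2 * s) ^ s ≤ n) : N ≤ (n / s) ^ s := by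
  have hsn : s ≤ n := by
    have h1 : 1 ≤ 10 ^ c := Nat.one_le_pow _ _ (by norm_num)
    have h2 : 2 * s ≤ (2 * s) ^ s := Nat.le_self_pow (by omega) _
    nlinarith
  have h1 : n ≤ 2 * s * (n / s) := by
    have h2 := Nat.div_add_mod n s
    have h3 := Nat.mod_lt n (show 0 < s by omega)
    have h4 : 1 ≤ n / s := (Nat.one_le_div_iff (by omega)).2 hsn
    nlinarith
  refine hN.trans ?_
  refine Nat.le_of_mul_le_mul_left ?_ (show 0 < (2 * s) ^ s from Nat.pow_pos (by omega))
  calc (2 * s) ^ s * (10 ^ c * n ^ (2 * c))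
      = (10 ^ c * (2 * s) ^ s) * n ^ (2 * c) := by ring
    _ ≤ n * n ^ (2 * c) := Nat.mul_le_mul_right _ hn
    _ = n ^ (2 * c + 1) := (pow_succ' _ _).symm
    _ ≤ n ^ s := Nat.pow_le_pow_right (by omega) (by omega)
    _ ≤ (2 * s * (n / s)) ^ s := Nat.pow_le_pow_left h1 s
    _ = (2 * s) ^ s * (n / s) ^ s := mul_pow _ _ _

/-- The union bound for the event that the clique contains one of the `N` sets of
`4 * c + 3` vertices. -/
theorem spoiled_le {c n k N D : ℕ} (hn : 0 < n) (hkn : k ≤ n)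
    (hN : N ≤ 10 ^ c * n ^ (2 * c)) (hk : k ^ 2 ≤ D * n) :
    (N : ℝ≥0∞) * ((k : ℝ≥0∞) ^ (4 * c + 3) / (n : ℝ≥0∞) ^ (4 * c + 3)) ≤
      ((10 ^ c * D ^ (2 * c + 1) : ℕ) : ℝ≥0∞) * (n : ℝ≥0∞)⁻¹ := by
  have h1 : N * k ^ (4 * c + 3) * n ≤ 10 ^ c * D ^ (2 * c + 1) * n ^ (4 * c + 3) := by
    have h2 : k ^ (4 * c + 3) ≤ (D * n) ^ (2 * c + 1) * n := by
      calc k ^ (4 * c + 3) = (k ^ 2) ^ (2 * c + 1) * k := by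
            rw [← pow_mul, ← pow_succ]
            ring_nf
        _ ≤ (D * n) ^ (2 * c + 1) * n := Nat.mul_le_mul (Nat.pow_le_pow_left hk _) hkn
    calc N * k ^ (4 * c + 3) * n
        ≤ 10 ^ c * n ^ (2 * c) * ((D * n) ^ (2 * c + 1) * n) * n :=
          Nat.mul_le_mul_right _ (Nat.mul_le_mul hN h2)
      _ = 10 ^ c * D ^ (2 * c + 1) * n ^ (4 * c + 3) := by ring
  have hn0 : (n : ℝ≥0∞) ≠ 0 := by exact_mod_cast hn.ne'
  rw [← div_eq_mul_inv, ENNReal.le_div_iff_mul_le (Or.inl hn0)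
    (Or.inl (ENNReal.natCast_ne_top n)), ← mul_div_assoc, ENNReal.mul_comm_div, ← mul_div_assoc]
  refine ENNReal.div_le_of_le_mul ?_
  exact_mod_cast h1

theorem exists_sq_le {n k : ℕ → ℕ} (hnpos : ∀ i, 0 < n i) {δ : ℝ} (hδ : 0 < δ)
    (hkO : (fun i => (k i : ℝ)) =O[atTop] fun i => (n i : ℝ) ^ (1 / 2 - δ)) :
    ∃ D : ℕ, ∀ᶠ i in atTop, k i ^ 2 ≤ D * n i := by
  obtain ⟨C, hC, hb⟩ := hkO.exists_pos
  refine ⟨⌈C ^ 2⌉₊, ?_⟩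
  filter_upwards [hb.bound] with i hi
  have hn1 : (1 : ℝ) ≤ n i := by exact_mod_cast hnpos i
  have hn0 : (0 : ℝ) ≤ n i := by linarith
  have h1 : (k i : ℝ) ≤ C * (n i : ℝ) ^ (1 / 2 : ℝ) := by
    rw [Real.norm_of_nonneg (by positivity), Real.norm_of_nonneg (by positivity)] at hi
    refine hi.trans (mul_le_mul_of_nonneg_left ?_ hC.le)
    exact Real.rpow_le_rpow_of_exponent_le hn1 (by linarith)
  have h2 : ((n i : ℝ) ^ (1 / 2 : ℝ)) ^ 2 = n i := by
    rw [← Real.sqrt_eq_rpow, Real.sq_sqrt hn0]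
  have h3 : (k i : ℝ) ^ 2 ≤ C ^ 2 * n i := by
    rw [← h2, ← mul_pow]
    exact pow_le_pow_left₀ (by positivity) h1 2
  have h4 : C ^ 2 * (n i : ℝ) ≤ ⌈C ^ 2⌉₊ * n i :=
    mul_le_mul_of_nonneg_right (Nat.le_ceil _) hn0
  exact_mod_cast h3.trans h4

/-- The growth condition is not affected if `t` is added to both sequences. -/
theorem isBigO_add_left {n k : ℕ → ℕ} (t : ℕ) (hnpos : ∀ i, 0 < n i) (hkpos : ∀ i, 0 < k i)
    {γ : ℝ} (hkO : (fun i => (k i : ℝ)) =O[atTop] fun i => (n i : ℝ) ^ γ) :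
    (fun i => ((t + k i : ℕ) : ℝ)) =O[atTop] fun i => ((t + n i : ℕ) : ℝ) ^ γ := by
  have hle : ∀ m : ℕ, 0 < m → ((t + m : ℕ) : ℝ) ≤ (t + 1) * m := by
    intro m hm
    have : (1 : ℝ) ≤ m := by exact_mod_cast hm
    push_cast
    nlinarith [Nat.cast_nonneg (α := ℝ) t]
  have h1 : (fun i => ((t + k i : ℕ) : ℝ)) =O[atTop] fun i => (k i : ℝ) := by
    refine IsBigO.of_bound (t + 1) (Eventually.of_forall fun i => ?_)
    rw [Real.norm_of_nonneg (by positivity), Real.norm_of_nonneg (by positivity)]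
    exact hle _ (hkpos i)
  -- as `n ≤ t + n ≤ (t + 1) * n`, the powers differ by a factor of at most `(t + 1) ^ |γ|`
  have h2 : (fun i => (n i : ℝ) ^ γ) =O[atTop] fun i => ((t + n i : ℕ) : ℝ) ^ γ := by
    refine IsBigO.of_bound (((t : ℝ) + 1) ^ |γ|) (Eventually.of_forall fun i => ?_)
    have hn0 : (0 : ℝ) < n i := by exact_mod_cast hnpos i
    have hm0 : (0 : ℝ) < (t + n i : ℕ) := by exact_mod_cast Nat.add_pos_right t (hnpos i)
    rw [Real.norm_of_nonneg (by positivity), Real.norm_of_nonneg (by positivity)]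
    rcases le_total 0 γ with h | h
    · have h3 : (n i : ℝ) ^ γ ≤ ((t + n i : ℕ) : ℝ) ^ γ :=
        Real.rpow_le_rpow hn0.le (by push_cast; linarith [Nat.cast_nonneg (α := ℝ) t]) h
      refine h3.trans (le_mul_of_one_le_left (by positivity) ?_)
      exact Real.one_le_rpow (by linarith [Nat.cast_nonneg (α := ℝ) t]) (abs_nonneg γ)
    · have h3 : (((t : ℝ) + 1) * n i) ^ γ ≤ ((t + n i : ℕ) : ℝ) ^ γ :=
        Real.rpow_le_rpow_of_nonpos hm0 (hle _ (hnpos i)) h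
      rw [Real.mul_rpow (by positivity) hn0.le] at h3
      have h4 : ((t : ℝ) + 1) ^ |γ| * ((t : ℝ) + 1) ^ γ = 1 := by
        rw [← Real.rpow_add (by positivity), abs_of_nonpos h, neg_add_cancel, Real.rpow_zero]
      calc (n i : ℝ) ^ γ = ((t : ℝ) + 1) ^ |γ| * (((t : ℝ) + 1) ^ γ * (n i : ℝ) ^ γ) := by
            rw [← mul_assoc, h4, one_mul]
        _ ≤ _ := mul_le_mul_of_nonneg_left h3 (by positivity)
  exact (h1.trans hkO).trans h2

end PlantedClique

open PlantedClique in
theorem mainTheorem6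
    (hconj : PlantedClique.ClHPCConjSpace)
    (n k : ℕ → ℕ) (hn : Monotone n) (hk : Monotone k)
    (hnpos : ∀ i, 0 < n i) (hkpos : ∀ i, 0 < k i)
    (hninf : Tendsto n atTop atTop) (hkn : ∀ i, k i ≤ n i)
    (δ : ℝ) (hδ : 0 < δ)
    (hkO : (fun i => (k i : ℝ)) =O[atTop] fun i => (n i : ℝ) ^ (1 / 2 - δ))
    (S : PlantedClique.Machine) (hS : S.IsMultipleAccessLogspace) :
    ¬ PlantedClique.Solves S (PlantedClique.pcDetection n k hkn) := by
  rintro ⟨ε, hε, hsolve⟩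
  obtain ⟨c, hc⟩ := id hS
  -- with `t + 2 = 4 * c + 3` vertices per hyperedge there is room for all addressable bits
  set t := 4 * c + 1 with ht
  obtain ⟨A, hA, hsim⟩ := exists_simulating_machine S t hS
  obtain ⟨D, hD⟩ := exists_sq_le hnpos hδ hkO
  have hconjA := hconj A hA (t + 2) (by omega) (fun i => t + n i) (fun i => t + k i)
    (fun _ _ h => Nat.add_le_add_left (hn h) t) (fun _ _ h => Nat.add_le_add_left (hk h) t)
    (fun i => Nat.add_pos_right t (hnpos i)) (fun i => Nat.add_pos_right t (hkpos i))
    (tendsto_atTop_mono (fun i => Nat.le_add_left _ t) hninf)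
    (fun i => Nat.le_add_right _ _) (fun i => Nat.add_le_add_left (hkn i) t)
    ⟨δ, hδ, isBigO_add_left t hnpos hkpos hkO⟩
  have herr : Tendsto (fun i => ((10 ^ c * D ^ (2 * c + 1) : ℕ) : ℝ≥0∞) * (n i : ℝ≥0∞)⁻¹)
      atTop (𝓝 0) := by
    have := ENNReal.Tendsto.const_mul (a := ((10 ^ c * D ^ (2 * c + 1) : ℕ) : ℝ≥0∞))
      (ENNReal.tendsto_inv_nat_nhds_zero.comp hninf) (Or.inr (ENNReal.natCast_ne_top _))
    simpa using this
  have hlim := hconjA.add herr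
  rw [add_zero] at hlim
  have hle : ∀ᶠ i in atTop, 1 + (ε : ℝ≥0∞) ≤
      outputProb A ((erdosRenyi (t + 2) (t + n i)).map
          (encodeHypergraph (t + 2) (t + n i) (t + k i))) false +
        outputProb A ((cliqueLeakage (t + 2) (t + n i) (t + k i) (Nat.le_add_right _ _)
          (Nat.add_le_add_left (hkn i) t)).map
            (encodeHypergraph (t + 2) (t + n i) (t + k i))) true +
        ((10 ^ c * D ^ (2 * c + 1) : ℕ) : ℝ≥0∞) * (n i : ℝ≥0∞)⁻¹ := by
    filter_upwards [hsolve, hD, hninf.eventually_ge_atTop (10 ^ c * (2 * (t + 2)) ^ (t + 2))]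
      with i h1 h2 h3
    have hNle := addressable_le c (hnpos i) (hkn i)
    have hN := le_div_pow (s := t + 2) (by omega) hNle h3
    have hreg : ∀ (G : UniformHypergraph 2 (n i)) ro ma u r,
        (S.run (encodeGraph (n i) (k i) G) ro ma u).reg r <
          2 ^ (c * Nat.log 2 (n i + 1 + (k i + 1) + n i ^ 2) + c) := by
      intro G ro ma u r
      rw [← length_encodeGraph (n i) (k i) G]
      exact ((hc _ ro ma).2 u).reg_lt r
    simp only [pcDetection, iInf_singleton] at h1
    refine h1.trans ?_
    rw [← outputProb_null hN S A (k i) hsim hreg (by omega) false]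
    refine le_trans (add_le_add_right ?_ _) (add_assoc _ _ _).ge
    refine (outputProb_planted_le hN S A (k i) hsim hreg (by omega) (hnpos i) (hkn i)
      (Nat.le_add_right _ _) (Nat.add_le_add_left (hkn i) t) true).trans ?_
    exact add_le_add_right (spoiled_le (hnpos i) (hkn i) hNle h2) _
  have hfinal : 1 + (ε : ℝ≥0∞) ≤ 1 := ge_of_tendsto hlim hle
  have : (1 : ℝ≥0∞) < 1 + ε := ENNReal.lt_add_right ENNReal.one_ne_top (by exact_mod_cast hε.ne')
  exact absurd hfinal (not_le.2 this)
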